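/- Let $\gamma$ be Euler's constant and, for $k\ge 0$, let $$\gamma_k=\lim_{N\to\infty}\Big(\sum_{n=1}^N\frac{\log^k n}{n}-\frac{\log^{k+1}N}{k+1}\Big)$$ be the Euler–Stieltjes constants. For $0<a\le 1$ let $\zeta(s,a)$ be the Hurwitz zeta function (the meromorphic continuation of $\sum_{n\ge0}(n+a)^{-s}$), let $\zeta^{(k)}(0,a)$ be its $k$-th derivative in $s$ at $s=0$, and let the generalized Stieltjes constants $\gamma_n(a)$ be defined by the Laurent expansion $$\zeta(s,a)=\frac1{s-1}+\sum_{n=0}^\infty\frac{(-1)^n\gamma_n(a)}{n!}(s-1)^n .$$ Let $r,q$ be positive integers with $r<q$. Put $$M=\gamma+\log(2\pi q),\qquad A_k=\sum_{l=1}^{q-1}\cos\frac{2\pi rl}{q}\,\zeta^{(k)}\Big(0,\frac lq\Big),\qquad B=\sum_{l=1}^{q-1}\sin\frac{2\pi rl}{q}\,\zeta''\Big(0,\frac lq\Big),$$ $$G=\sum_{l=1}^{q-1}\sin\frac{2\pi rl}{q}\,\log\Gamma\Big(\frac lq\Big),\qquad S=\sum_{l=1}^{q-1}\cos\frac{2\pi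 rl}{q}\,\log\sin\frac{\pi l}{q}.$$ Then $$\gamma_0\Big(\frac rq\Big)=\gamma+\log(2q)+\frac\pi2\cot\frac{\pi r}{q}-S,$$ $$\gamma_1\Big(\frac rq\Big)=\gamma_1-\gamma\log(2q)-\frac\pi2\,M\cot\frac{\pi r}{q}+A_2+\pi G+M S-\log^2 2-\log 2\cdot\log(\pi q)-\frac12\log^2 q,$$ $$\gamma_2\Big(\frac rq\Big)=\gamma_2-2\gamma_1\log q+\gamma\log^2 q+\frac13\log^3 q+\frac23A_3+\pi B-2M\,(A_2+\pi G)+\Big(M^2-\frac{\pi^2}{12}\Big)(\log 2-S)+\frac\pi2\Big(M^2+\frac{\pi^2}{12}\Big)\cot\frac{\pi r}{q}.$$ -/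

import Mathlib

open Filter Topology

/-- The partial expressions `∑_{n=1}^N (log n)^k / n - (log N)^(k+1) / (k+1)`. -/
noncomputable def stieltjesApprox (k N : ℕ) : ℝ :=
  (∑ n ∈ Finset.Icc 1 N, Real.log n ^ k / n) - Real.log N ^ (k + 1) / (k + 1)

/-- The Euler-Stieltjes constant `γ_k`, the limit as `N → ∞` of
`∑_{n=1}^N (log n)^k / n - (log N)^(k+1) / (k+1)`; the limit exists by
`tendsto_stieltjesApprox`. -/
noncomputable def eulerStieltjes (k : ℕ) : ℝ :=
  limUnder atTop (stieltjesApprox k)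

/-- The regular part `ζ(s, a) - 1 / (s - 1)` of the Hurwitz zeta function at `s = 1`, with the
removable singularity at `s = 1` filled in by the limit. For `0 < a ≤ 1` this is the regular part
of the classical Hurwitz zeta function `ζ(s, a)`. -/
noncomputable def hurwitzRegularPart (a : ℝ) : ℂ → ℂ :=
  Function.update (fun s : ℂ => HurwitzZeta.hurwitzZeta (a : UnitAddCircle) s - 1 / (s - 1)) 1
    (limUnder (𝓝[≠] 1)
      (fun s : ℂ => HurwitzZeta.hurwitzZeta (a : UnitAddCircle) s - 1 / (s - 1)))

/-- The generalized Stieltjes constants `γ_n(a)`, `0 < a ≤ 1`: the coefficients in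
`ζ(s, a) = 1 / (s - 1) + ∑ (-1)^n γ_n(a) / n! (s - 1)^n`;
see `hasSum_generalizedStieltjes`. -/
noncomputable def generalizedStieltjes (n : ℕ) (a : ℝ) : ℂ :=
  (-1) ^ n * iteratedDeriv n (hurwitzRegularPart a) 1

/-- The `k`-th derivative at `s = 0` of the Hurwitz zeta function `s ↦ ζ(s, a)`, `0 < a ≤ 1`. -/
noncomputable def hurwitzDerivZero (k : ℕ) (a : ℝ) : ℂ :=
  iteratedDeriv k (HurwitzZeta.hurwitzZeta (a : UnitAddCircle)) 0

theorem differentiable_hurwitzRegularPart (a : ℝ) :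
    Differentiable ℂ (hurwitzRegularPart a) := by
  have hd : DifferentiableOn ℂ
      (fun s : ℂ => HurwitzZeta.hurwitzZeta (a : UnitAddCircle) s - 1 / (s - 1))
      (Set.univ \ {1}) := by
    intro s hs
    have hs1 : s ≠ 1 := by simpa using hs
    have : s - 1 ≠ 0 := sub_ne_zero.mpr hs1
    refine DifferentiableAt.differentiableWithinAt ?_
    exact (HurwitzZeta.differentiableAt_hurwitzZeta _ hs1).sub
      (DifferentiableAt.div (by fun_prop) (by fun_prop) this)
  have ho : (fun z : ℂ => (HurwitzZeta.hurwitzZeta (a : UnitAddCircle) z - 1 / (z - 1)) -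
      (HurwitzZeta.hurwitzZeta (a : UnitAddCircle) 1 - 1 / (1 - 1))) =o[𝓝[≠] 1]
        fun z => (z - 1)⁻¹ := by
    refine Asymptotics.isLittleO_of_tendsto' ?_ ?_
    · filter_upwards [self_mem_nhdsWithin] with z hz h
      exact absurd (inv_eq_zero.mp h) (sub_ne_zero.mpr hz)
    · have h1 := HurwitzZeta.hurwitzZeta_residue_one (a : UnitAddCircle)
      have h2 : Tendsto (fun z : ℂ => (z - 1) *
          (HurwitzZeta.hurwitzZeta (a : UnitAddCircle) 1 - 1 / (1 - 1))) (𝓝[≠] 1) (𝓝 0) := by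
        have : Continuous (fun z : ℂ => (z - 1) *
          (HurwitzZeta.hurwitzZeta (a : UnitAddCircle) 1 - 1 / (1 - 1))) := by fun_prop
        simpa using (this.tendsto 1).mono_left nhdsWithin_le_nhds
      have h3 := (h1.sub_const 1).sub h2
      rw [show (1 : ℂ) - 1 - 0 = 0 by norm_num] at h3
      refine h3.congr' ?_
      filter_upwards [self_mem_nhdsWithin] with z hz
      have : z - 1 ≠ 0 := sub_ne_zero.mpr hz
      field_simp
  have := Complex.differentiableOn_update_limUnder_of_isLittleO
    (s := Set.univ) (c := (1 : ℂ)) Filter.univ_mem hd ho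
  exact differentiableOn_univ.mp this

/-- The Laurent expansion of `ζ(s, a)` at `s = 1` has the coefficients `(-1)^n γ_n(a) / n!`. -/
theorem hasSum_generalizedStieltjes (a : ℝ) {s : ℂ} (hs : s ≠ 1) :
    HasSum (fun n : ℕ => (-1) ^ n * generalizedStieltjes n a / n.factorial * (s - 1) ^ n)
      (HurwitzZeta.hurwitzZeta (a : UnitAddCircle) s - 1 / (s - 1)) := by
  have h := Complex.hasSum_taylorSeries_of_entire (differentiable_hurwitzRegularPart a) 1 s
  have e : hurwitzRegularPart a s =
      HurwitzZeta.hurwitzZeta (a : UnitAddCircle) s - 1 / (s - 1) :=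
    Function.update_of_ne hs _ _
  rw [e] at h
  have key : (fun n : ℕ => (-1) ^ n * generalizedStieltjes n a / n.factorial * (s - 1) ^ n) =
      fun n : ℕ => (n.factorial : ℂ)⁻¹ • (s - 1) ^ n •
        iteratedDeriv n (hurwitzRegularPart a) 1 := by
    funext n
    have h1 : ((-1 : ℂ) ^ n) * (-1) ^ n = 1 := by rw [← mul_pow]; simp
    simp only [generalizedStieltjes, smul_eq_mul]
    rw [← mul_assoc, h1]
    ring
  rw [key]
  exact h

/-- The limit defining `γ_k` exists. -/
theorem tendsto_stieltjesApprox (k : ℕ) :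
    Tendsto (stieltjesApprox k) atTop (𝓝 (eulerStieltjes k)) := by
  refine tendsto_nhds_limUnder ?_
  set f : ℝ → ℝ := fun x => Real.log x ^ k / x with hf
  set F : ℝ → ℝ := fun x => Real.log x ^ (k + 1) / (k + 1) with hF
  have hF' : ∀ x : ℝ, 0 < x → HasDerivAt F (f x) x := by
    intro x hx
    have h := (((Real.hasDerivAt_log hx.ne').pow (k + 1)).div_const ((k : ℝ) + 1))
    have hk : (k : ℝ) + 1 ≠ 0 := by positivity
    have e : f x = ((k + 1 : ℕ) : ℝ) * Real.log x ^ (k + 1 - 1) * x⁻¹ / ((k : ℝ) + 1) := by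
      simp only [hf, Nat.add_sub_cancel]
      push_cast
      field_simp
    rw [e]
    exact h
  have hanti : AntitoneOn f (Set.Ici (Real.exp k)) := by
    refine antitoneOn_of_deriv_nonpos (convex_Ici _) ?_ ?_ ?_
    · intro x hx
      have hx0 : 0 < x := (Real.exp_pos _).trans_le hx
      exact (((Real.continuousAt_log hx0.ne').pow k).div continuousAt_id
        hx0.ne').continuousWithinAt
    · intro x hx
      rw [interior_Ici] at hx
      have hx0 : 0 < x := (Real.exp_pos _).trans hx
      exact (((Real.differentiableAt_log hx0.ne').pow k).div differentiableAt_id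
        hx0.ne').differentiableWithinAt
    · intro x hx
      rw [interior_Ici] at hx
      have hx0 : 0 < x := (Real.exp_pos _).trans hx
      have hl : (k : ℝ) < Real.log x := (Real.lt_log_iff_exp_lt hx0).mpr hx
      have h := ((Real.hasDerivAt_log hx0.ne').pow k).div (hasDerivAt_id x) hx0.ne'
      have hd : deriv f x = _ := h.deriv
      rw [hd]
      refine div_nonpos_of_nonpos_of_nonneg ?_ (by positivity)
      have hl0 : 0 < Real.log x := lt_of_le_of_lt (Nat.cast_nonneg k) hl
      rcases k with _ | m
      · simp
      · simp only [Nat.add_sub_cancel, id, Pi.pow_apply]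
        have h1 : ((m + 1 : ℕ) : ℝ) * Real.log x ^ m * x⁻¹ * x
            = ((m + 1 : ℕ) : ℝ) * Real.log x ^ m := by field_simp
        rw [h1, pow_succ]
        nlinarith [pow_pos hl0 m]
  obtain ⟨N, hN⟩ := exists_nat_ge (Real.exp k)
  have hstep : ∀ n : ℕ, stieltjesApprox k (n + 1) - stieltjesApprox k n
      = f ((n : ℝ) + 1) - (F ((n : ℝ) + 1) - F n) := by
    intro n
    simp only [stieltjesApprox, hf, hF]
    rw [Finset.sum_Icc_succ_top (by omega)]
    push_cast
    ring
  have hmvt : ∀ n : ℕ, N ≤ n →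
      f ((n : ℝ) + 1) ≤ F ((n : ℝ) + 1) - F n ∧ F ((n : ℝ) + 1) - F n ≤ f n := by
    intro n hn
    have hn' : Real.exp k ≤ n := hN.trans (by exact_mod_cast hn)
    have hn0 : (0 : ℝ) < n := (Real.exp_pos _).trans_le hn'
    obtain ⟨c, hc, hc'⟩ := exists_hasDerivAt_eq_slope F f (by linarith : (n : ℝ) < n + 1)
      (fun x hx => (hF' x (hn0.trans_le hx.1)).continuousAt.continuousWithinAt)
      (fun x hx => hF' x (hn0.trans hx.1))
    rw [add_sub_cancel_left, div_one] at hc'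
    rw [← hc']
    have hck : Real.exp k ≤ c := hn'.trans hc.1.le
    exact ⟨hanti hck (hck.trans hc.2.le) hc.2.le, hanti hn' hck hc.1.le⟩
  have hA : Antitone (fun n : ℕ => stieltjesApprox k (n + N)) := by
    refine antitone_nat_of_succ_le fun n => ?_
    have h1 := hstep (n + N)
    have h2 := hmvt (n + N) (by omega)
    rw [show n + 1 + N = n + N + 1 by ring]
    linarith [h2.1]
  have hB : Monotone (fun n : ℕ => stieltjesApprox k (n + N) - f ((n + N : ℕ) : ℝ)) := by
    refine monotone_nat_of_le_succ fun n => ?_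
    have h1 := hstep (n + N)
    have h2 := hmvt (n + N) (by omega)
    rw [show n + 1 + N = n + N + 1 by ring, Nat.cast_succ (n + N)]
    linarith [h2.2]
  have hbdd : BddBelow (Set.range (fun n : ℕ => stieltjesApprox k (n + N))) := by
    refine ⟨stieltjesApprox k (0 + N) - f ((0 + N : ℕ) : ℝ), ?_⟩
    rintro _ ⟨n, rfl⟩
    have h1 := hB (Nat.zero_le n)
    have h2 : 0 ≤ f ((n + N : ℕ) : ℝ) :=
      div_nonneg (pow_nonneg (Real.log_natCast_nonneg _) _) (Nat.cast_nonneg _)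
    simp only at h1 ⊢
    linarith
  exact ⟨_, (tendsto_add_atTop_iff_nat N).mp (tendsto_atTop_ciInf hA hbdd)⟩

/-! Hurwitz's formula at a rational argument writes `ζ(1 - x, r/q)` as `2 Γ(x) (2πq)^(-x)` times the
sum over `l mod q` of `cos(πx/2 - 2πrl/q) ζ(x, l/q)`. The class `l = 0` contributes `q^(-x) ζ(1 -
x)`, by Riemann's functional equation. After multiplication by `x`, everything is analytic near `x =
0`. The coefficients of `x`, `x²`, `x³` on the left are `γ₀(r/q)`, `γ₁(r/q)`, `γ₂(r/q)/2`, so the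
theorem is a comparison of third-order expansions (`mul_hurwitzRegularPart_natCast_div`,
`HasCubicExpansion.unique`).

The expansions need four inputs. The Laurent coefficients of `ζ` at `1` are the limits `γ_k`
(`generalizedStieltjes_zero_right`). The first Taylor coefficients of `ζ(s, a)` at `0` are `1/2 - a`
and, by Lerch, `log Γ(a) - log(2π)/2`. The expansion of `Γ(1 + x)` through `x²` follows from the
reflection formula. Finally, finite trigonometric sums turn the resulting averages into `cot` and
`log sin`.

Both zeta inputs are limits of entire functions whose increments are second-order Taylor remainders
of a power `t^w`. This gains enough decay for locally uniform convergence past the half plane of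
absolute convergence, and such convergence passes to derivatives. -/

/-! ### Locally uniform convergence, and Taylor remainders of powers. -/

/-- The Weierstrass test for the telescoping series gives some holomorphic limit on `U`; it agrees
with `f` on `V`, hence on `U` by the identity theorem. Thus the limit need only be identified where
the Dirichlet series converges. -/
theorem tendstoLocallyUniformlyOn_of_norm_sub_le {F : ℕ → ℂ → ℂ} {f : ℂ → ℂ} {U V : Set ℂ}
    (hU : IsOpen U) (hUc : IsPreconnected U) (hV : IsOpen V) (hVn : V.Nonempty) (hVU : V ⊆ U)
    (hF : ∀ n, Differentiable ℂ (F n)) (hf : DifferentiableOn ℂ f U)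
    (hlim : ∀ s ∈ V, Tendsto (fun n => F n s) atTop (𝓝 (f s)))
    (hb : ∀ z ∈ U, ∃ W ∈ 𝓝 z, ∃ M : ℕ → ℝ, Summable M ∧
      ∀ n, ∀ s ∈ W, ‖F (n + 1) s - F n s‖ ≤ M n) :
    TendstoLocallyUniformlyOn F f atTop U := by
  set g : ℂ → ℂ := fun s => F 0 s + ∑' n, (F (n + 1) s - F n s) with hg
  have hFg : TendstoLocallyUniformlyOn F g atTop U := by
    rw [Metric.tendstoLocallyUniformlyOn_iff]
    intro ε hε z hz
    obtain ⟨W, hW, M, hM, hMb⟩ := hb z hz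
    refine ⟨W, mem_nhdsWithin_of_mem_nhds hW, ?_⟩
    have h := Metric.tendstoUniformlyOn_iff.mp (tendstoUniformlyOn_tsum_nat hM hMb) ε hε
    filter_upwards [h] with N hN s hs
    have h1 := hN s hs
    rw [Finset.sum_range_sub (fun n => F n s) N] at h1
    rw [dist_eq_norm] at h1 ⊢
    convert h1 using 2
    simp only [hg]
    ring
  have hgd : DifferentiableOn ℂ g U :=
    hFg.differentiableOn (Eventually.of_forall fun n => (hF n).differentiableOn) hU
  have hgf : Set.EqOn g f U := by
    obtain ⟨z₀, hz₀⟩ := hVn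
    refine (hgd.analyticOnNhd hU).eqOn_of_preconnected_of_eventuallyEq (hf.analyticOnNhd hU) hUc
      (hVU hz₀) ?_
    filter_upwards [hV.mem_nhds hz₀] with s hs
    exact tendsto_nhds_unique (hFg.tendsto_at (hVU hs)) (hlim s hs)
  exact hFg.congr_right hgf

/-- The mean value inequality is applied twice: to `w t^(w-1)`, then to `t^w` minus its linear part
at `x`. The condition `re w ≤ 2` makes the size of the second derivative decreasing in `t`, so that
it is largest at `b`. -/
theorem norm_ofReal_cpow_sub_sub_le {w : ℂ} (hw : w.re ≤ 2) {b x y : ℝ} (hb : 0 < b)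
    (hx : b ≤ x) (hy : b ≤ y) :
    ‖(y : ℂ) ^ w - (x : ℂ) ^ w - w * (x : ℂ) ^ (w - 1) * (y - x)‖ ≤
      ‖w‖ * ‖w - 1‖ * b ^ (w.re - 2) * (y - x) ^ 2 := by
  have hd : ∀ (v : ℂ) (t : ℝ), t ∈ Set.Ici b →
      HasDerivAt (fun t : ℝ => (t : ℂ) ^ v) (v * (t : ℂ) ^ (v - 1)) t := by
    intro v t ht
    have ht0 : t ≠ 0 := (hb.trans_le ht).ne'
    rcases eq_or_ne v 0 with rfl | hv
    · simpa using hasDerivAt_const t (1 : ℂ)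
    · exact hasDerivAt_ofReal_cpow_const ht0 hv
  have hK : 0 ≤ ‖w‖ * ‖w - 1‖ * b ^ (w.re - 2) := by positivity
  have h1 : ∀ t ∈ Set.Ici b, ∀ u ∈ Set.Ici b,
      ‖w * (u : ℂ) ^ (w - 1) - w * (t : ℂ) ^ (w - 1)‖ ≤
        ‖w‖ * ‖w - 1‖ * b ^ (w.re - 2) * ‖u - t‖ := by
    intro t ht u hu
    refine Convex.norm_image_sub_le_of_norm_hasDerivWithin_le
      (f := fun t : ℝ => w * (t : ℂ) ^ (w - 1))
      (f' := fun t : ℝ => w * ((w - 1) * (t : ℂ) ^ (w - 1 - 1))) (s := Set.Ici b)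
      (fun v hv => ((hd (w - 1) v hv).const_mul w).hasDerivWithinAt) ?_ (convex_Ici b) ht hu
    intro v hv
    have hv0 : 0 < v := hb.trans_le hv
    rw [norm_mul, norm_mul, Complex.norm_cpow_eq_rpow_re_of_pos hv0, ← mul_assoc]
    have e : (w - 1 - 1).re = w.re - 2 := by simp; ring
    rw [e]
    exact mul_le_mul_of_nonneg_left
      (Real.rpow_le_rpow_of_nonpos hb hv (by linarith)) (by positivity)
  have h2 := Convex.norm_image_sub_le_of_norm_hasDerivWithin_le
      (f := fun t : ℝ => (t : ℂ) ^ w - w * (x : ℂ) ^ (w - 1) * t)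
      (f' := fun t : ℝ => w * (t : ℂ) ^ (w - 1) - w * (x : ℂ) ^ (w - 1) * 1)
      (s := Set.uIcc x y) (C := ‖w‖ * ‖w - 1‖ * b ^ (w.re - 2) * ‖y - x‖) (x := x) (y := y)
      ?_ ?_ (convex_uIcc x y) Set.left_mem_uIcc Set.right_mem_uIcc
  · calc _ = ‖(y : ℂ) ^ w - w * (x : ℂ) ^ (w - 1) * y -
          ((x : ℂ) ^ w - w * (x : ℂ) ^ (w - 1) * x)‖ := by congr 1; ring
      _ ≤ _ := h2
      _ = _ := by rw [mul_assoc _ ‖y - x‖, Real.norm_eq_abs, abs_mul_abs_self, sq]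
  · intro t ht
    have htb : t ∈ Set.Ici b := (le_min hx hy).trans ht.1
    exact ((hd w t htb).sub
      ((Complex.ofRealCLM.hasDerivAt (x := t)).const_mul _)).hasDerivWithinAt
  · intro t ht
    have htb : t ∈ Set.Ici b := (le_min hx hy).trans ht.1
    rw [mul_one]
    refine (h1 x hx t htb).trans (mul_le_mul_of_nonneg_left ?_ hK)
    exact Set.abs_sub_left_of_mem_uIcc ht

theorem TendstoLocallyUniformlyOn.iteratedDeriv_of_differentiable {F : ℕ → ℂ → ℂ} {f : ℂ → ℂ}
    {U : Set ℂ} (h : TendstoLocallyUniformlyOn F f atTop U) (hU : IsOpen U)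
    (hF : ∀ n, Differentiable ℂ (F n)) (k : ℕ) :
    TendstoLocallyUniformlyOn (fun n => iteratedDeriv k (F n)) (iteratedDeriv k f) atTop U := by
  induction k with
  | zero => simpa only [iteratedDeriv_zero] using h
  | succ k ih =>
    simp only [iteratedDeriv_succ]
    refine ih.deriv (Eventually.of_forall fun n => ?_) hU
    exact ((hF n).contDiff.differentiable_iteratedDeriv (n := ((k + 1 : ℕ) : WithTop ℕ∞)) k
      (by exact_mod_cast Nat.lt_succ_self k)).differentiableOn

theorem iteratedDeriv_succ_sub_mul {h : ℂ → ℂ} (hh : Differentiable ℂ h) (c : ℂ) (k : ℕ) :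
    iteratedDeriv (k + 1) (fun s => (s - c) * h s) =
      fun s => (s - c) * iteratedDeriv (k + 1) h s + (k + 1) * iteratedDeriv k h s := by
  have hd : ∀ k, Differentiable ℂ (iteratedDeriv k h) := fun k =>
    hh.contDiff.differentiable_iteratedDeriv (n := ((k + 1 : ℕ) : WithTop ℕ∞)) k
      (by exact_mod_cast Nat.lt_succ_self k)
  have key : ∀ k s, HasDerivAt (fun s => (s - c) * iteratedDeriv k h s)
      (iteratedDeriv k h s + (s - c) * iteratedDeriv (k + 1) h s) s := by
    intro k s
    have h1 := ((hasDerivAt_id s).sub_const c).mul (hd k s).hasDerivAt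
    rw [← iteratedDeriv_succ, one_mul] at h1
    exact h1
  induction k with
  | zero =>
    funext s
    rw [iteratedDeriv_one]
    have h1 := (key 0 s).deriv
    simp only [iteratedDeriv_zero] at h1 ⊢
    rw [h1]
    push_cast
    ring
  | succ k ih =>
    rw [iteratedDeriv_succ, ih]
    funext s
    have h1 := ((key (k + 1) s).add
      (((hd k s).hasDerivAt).const_mul ((k : ℂ) + 1))).deriv
    rw [← iteratedDeriv_succ] at h1
    refine h1.trans ?_
    push_cast
    ring

theorem ofReal_cpow_eq_cexp {x : ℝ} (hx : 0 < x) (s : ℂ) :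
    (x : ℂ) ^ s = Complex.exp ((Real.log x : ℂ) * s) := by
  rw [Complex.cpow_def_of_ne_zero (by exact_mod_cast hx.ne'), Complex.ofReal_log hx.le]

/-! ### Laurent coefficients of the Riemann zeta function at 1. -/

/-- Partial expressions converging to `(s - 1) ζ(s)` on the half plane `0 < re s`. -/
noncomputable def zetaApprox (n : ℕ) (s : ℂ) : ℂ :=
  (s - 1) * (∑ m ∈ Finset.range (n + 1), (((m + 1 : ℕ) : ℝ) : ℂ) ^ (-s)) +
    (((n + 1 : ℕ) : ℝ) : ℂ) ^ (1 - s)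

theorem differentiable_ofReal_cpow {x : ℝ} (hx : 0 < x) {g : ℂ → ℂ} (hg : Differentiable ℂ g) :
    Differentiable ℂ (fun s => (x : ℂ) ^ g s) := by
  simp only [ofReal_cpow_eq_cexp hx]
  fun_prop

theorem differentiable_zetaApprox (n : ℕ) : Differentiable ℂ (zetaApprox n) := by
  unfold zetaApprox
  refine Differentiable.add (Differentiable.mul (by fun_prop) ?_)
    (differentiable_ofReal_cpow (by positivity) (by fun_prop))
  exact Differentiable.fun_sum fun m _ =>
    differentiable_ofReal_cpow (by positivity) (by fun_prop)

/-- Up to sign, the increment is the Taylor remainder of `t^(1-s)` at `n + 2`, evaluated at `n + 1`.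
-/
theorem norm_zetaApprox_succ_sub_le (n : ℕ) {s : ℂ} (hs : 0 ≤ s.re) :
    ‖zetaApprox (n + 1) s - zetaApprox n s‖ ≤
      ‖s - 1‖ * ‖s‖ * ((n : ℝ) + 1) ^ (-1 - s.re) := by
  have h := norm_ofReal_cpow_sub_sub_le (w := 1 - s) (by simp; linarith)
    (b := (n : ℝ) + 1) (x := (n : ℝ) + 2) (y := (n : ℝ) + 1) (by positivity) (by linarith) le_rfl
  have e1 : (1 - s - 1) = -s := by ring
  have e2 : (1 - s).re - 2 = -1 - s.re := by simp; ring
  rw [e1, e2, norm_neg, norm_sub_rev 1 s] at h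
  rw [← norm_neg]
  convert h using 1
  · congr 1
    unfold zetaApprox
    rw [Finset.sum_range_succ _ (n + 1)]
    push_cast
    ring_nf
  · ring

theorem summable_nat_add_one_rpow {p : ℝ} (hp : p < -1) :
    Summable fun n : ℕ => ((n : ℝ) + 1) ^ p := by
  have := (summable_nat_add_iff 1).mpr (Real.summable_nat_rpow.mpr hp)
  simpa using this

theorem tendsto_natCast_add_one_cpow_zero {w : ℂ} (hw : w.re < 0) :
    Tendsto (fun n : ℕ => (((n + 1 : ℕ) : ℝ) : ℂ) ^ w) atTop (𝓝 0) := by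
  rw [tendsto_zero_iff_norm_tendsto_zero]
  have h := (tendsto_rpow_neg_atTop (y := -w.re) (by linarith)).comp
    (tendsto_natCast_atTop_atTop (R := ℝ) |>.comp (tendsto_add_atTop_nat 1))
  refine h.congr fun n => ?_
  rw [Complex.norm_cpow_eq_rpow_re_of_pos (by positivity)]
  simp

theorem hurwitzRegularPart_of_ne {a : ℝ} {s : ℂ} (hs : s ≠ 1) :
    hurwitzRegularPart a s = HurwitzZeta.hurwitzZeta (a : UnitAddCircle) s - 1 / (s - 1) :=
  Function.update_of_ne hs _ _

theorem tendsto_zetaApprox_of_one_lt_re {s : ℂ} (hs : 1 < s.re) :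
    Tendsto (fun n => zetaApprox n s) atTop (𝓝 (1 + (s - 1) * hurwitzRegularPart 0 s)) := by
  have hs1 : s ≠ 1 := by rintro rfl; simp at hs
  have hs1' : s - 1 ≠ 0 := sub_ne_zero.mpr hs1
  have e : 1 + (s - 1) * hurwitzRegularPart 0 s = (s - 1) * riemannZeta s + 0 := by
    rw [hurwitzRegularPart_of_ne hs1, QuotientAddGroup.mk_zero, HurwitzZeta.hurwitzZeta_zero]
    field_simp
    ring
  rw [e]
  refine Tendsto.add (Tendsto.const_mul _ ?_) (tendsto_natCast_add_one_cpow_zero ?_)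
  · have h := HurwitzZeta.hasSum_hurwitzZeta_of_one_lt_re (a := 1) (by simp) hs
    have e1 : ((1 : ℝ) : UnitAddCircle) = 0 := AddCircle.coe_period 1
    rw [e1, HurwitzZeta.hurwitzZeta_zero] at h
    refine ((h.tendsto_sum_nat).comp (tendsto_add_atTop_nat 1)).congr fun n => ?_
    refine Finset.sum_congr rfl fun m _ => ?_
    rw [Complex.cpow_neg, one_div]
    push_cast
    rfl
  · simp; linarith

theorem tendstoLocallyUniformlyOn_zetaApprox :
    TendstoLocallyUniformlyOn zetaApprox (fun s => 1 + (s - 1) * hurwitzRegularPart 0 s) atTop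
      {s : ℂ | 0 < s.re} := by
  have hre : ∀ c : ℝ, IsOpen {s : ℂ | c < s.re} := fun c =>
    isOpen_lt continuous_const Complex.continuous_re
  refine tendstoLocallyUniformlyOn_of_norm_sub_le (V := {s : ℂ | 1 < s.re}) (hre 0)
    (convex_halfSpace_re_gt 0).isPreconnected (hre 1) ⟨2, by simp⟩
    (fun s (hs : 1 < s.re) => show 0 < s.re from zero_lt_one.trans hs) differentiable_zetaApprox ?_
    (fun s hs => tendsto_zetaApprox_of_one_lt_re hs) ?_
  · have := differentiable_hurwitzRegularPart 0
    exact Differentiable.differentiableOn (by fun_prop)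
  · intro z hz
    rw [Set.mem_ofPred_eq] at hz
    -- Halving `re z` keeps the exponent `-1 - re s` below a fixed number less than `-1`; the unit
    -- ball bounds the polynomial factors.
    refine ⟨{s : ℂ | z.re / 2 < s.re} ∩ Metric.ball z 1,
      inter_mem ((hre _).mem_nhds (by simp; linarith)) (Metric.ball_mem_nhds z one_pos),
      fun n => (‖z‖ + 2) * (‖z‖ + 1) * ((n : ℝ) + 1) ^ (-1 - z.re / 2),
      (summable_nat_add_one_rpow (by linarith)).mul_left _, ?_⟩
    rintro n s ⟨hs1, hs2⟩
    rw [Set.mem_ofPred_eq] at hs1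
    rw [mem_ball_iff_norm] at hs2
    have h1 : ‖s‖ ≤ ‖z‖ + 1 := by
      have := norm_add_le (s - z) z
      rw [sub_add_cancel] at this
      linarith
    have h2 : ‖s - 1‖ ≤ ‖z‖ + 2 := by
      have := norm_sub_le s 1
      rw [norm_one] at this
      linarith
    refine (norm_zetaApprox_succ_sub_le n (by linarith)).trans ?_
    dsimp only
    gcongr
    · linarith [(Nat.cast_nonneg n : (0 : ℝ) ≤ n)]

theorem iteratedDeriv_ofReal_cpow_neg {x : ℝ} (hx : 0 < x) (k : ℕ) (s : ℂ) :
    iteratedDeriv k (fun s : ℂ => (x : ℂ) ^ (-s)) s =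
      (-(Real.log x : ℂ)) ^ k * (x : ℂ) ^ (-s) := by
  have e : (fun s : ℂ => (x : ℂ) ^ (-s)) = fun s => Complex.exp (-(Real.log x : ℂ) * s) := by
    funext s
    rw [ofReal_cpow_eq_cexp hx]
    ring_nf
  rw [e, iteratedDeriv_cexp_const_mul, ofReal_cpow_eq_cexp hx]
  ring_nf

/-- At `s = 1` only the Leibniz term that differentiates `s - 1` once survives. It gives the sum of
`log^k m / m`, while `(n+1)^(1-s)` supplies the subtracted power of the logarithm. -/
theorem iteratedDeriv_zetaApprox_one (k n : ℕ) :
    iteratedDeriv (k + 1) (zetaApprox n) 1 =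
      (k + 1) * ((-1) ^ k * (stieltjesApprox k (n + 1) : ℂ)) := by
  set h : ℂ → ℂ := fun s => ∑ m ∈ Finset.range (n + 1), (((m + 1 : ℕ) : ℝ) : ℂ) ^ (-s) with hh
  have hm : ∀ m : ℕ, Differentiable ℂ (fun s : ℂ => (((m + 1 : ℕ) : ℝ) : ℂ) ^ (-s)) := fun m =>
    differentiable_ofReal_cpow (by positivity) (by fun_prop)
  have hd : Differentiable ℂ h := Differentiable.fun_sum fun m _ => hm m
  have hN : (0 : ℝ) < ((n + 1 : ℕ) : ℝ) := by positivity
  have hN' : (((n + 1 : ℕ) : ℝ) : ℂ) ≠ 0 := by exact_mod_cast hN.ne'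
  have e : zetaApprox n = fun s => (s - 1) * h s +
      (((n + 1 : ℕ) : ℝ) : ℂ) * (((n + 1 : ℕ) : ℝ) : ℂ) ^ (-s) := by
    funext s
    rw [zetaApprox, sub_eq_add_neg 1 s, Complex.cpow_add _ _ hN', Complex.cpow_one]
  have hc1 : ContDiff ℂ ((k + 1 : ℕ) : WithTop ℕ∞) (fun s => (s - 1) * h s) :=
    Differentiable.contDiff (by fun_prop)
  have hc2 : ContDiff ℂ ((k + 1 : ℕ) : WithTop ℕ∞)
      (fun s : ℂ => (((n + 1 : ℕ) : ℝ) : ℂ) * (((n + 1 : ℕ) : ℝ) : ℂ) ^ (-s)) :=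
    Differentiable.contDiff ((hm n).const_mul _)
  rw [e, iteratedDeriv_fun_add hc1.contDiffAt hc2.contDiffAt, iteratedDeriv_succ_sub_mul hd,
    iteratedDeriv_const_mul_field, iteratedDeriv_ofReal_cpow_neg hN, hh]
  simp only [sub_self, zero_mul, zero_add]
  rw [
    iteratedDeriv_fun_sum (fun m _ => (hm m).contDiff.contDiffAt)]
  have hk : (k : ℂ) + 1 ≠ 0 := by exact_mod_cast k.succ_ne_zero
  have hsum : ∑ m ∈ Finset.range (n + 1),
      iteratedDeriv k (fun s : ℂ => (((m + 1 : ℕ) : ℝ) : ℂ) ^ (-s)) 1 =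
      (-1) ^ k * ∑ m ∈ Finset.Icc 1 (n + 1), (Real.log m : ℂ) ^ k / m := by
    rw [Finset.range_eq_Ico, ← Finset.Ico_add_one_right_eq_Icc, ← Finset.sum_Ico_add' _ 0 (n + 1) 1,
      Finset.mul_sum]
    refine Finset.sum_congr (by simp) fun m _ => ?_
    rw [iteratedDeriv_ofReal_cpow_neg (by positivity), Complex.cpow_neg_one, neg_pow]
    push_cast
    ring
  rw [hsum, stieltjesApprox, Complex.cpow_neg_one]
  push_cast at hN' ⊢
  field_simp
  ring

/-- The Laurent coefficients of `ζ` at `s = 1` are the Euler-Stieltjes constants. -/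
theorem generalizedStieltjes_zero_right (k : ℕ) :
    generalizedStieltjes k 0 = (eulerStieltjes k : ℂ) := by
  have h1 := (tendstoLocallyUniformlyOn_zetaApprox.iteratedDeriv_of_differentiable
    (isOpen_lt continuous_const Complex.continuous_re) differentiable_zetaApprox
    (k + 1)).tendsto_at (a := 1) (by simp)
  rw [iteratedDeriv_const_add k.succ_pos,
    iteratedDeriv_succ_sub_mul (differentiable_hurwitzRegularPart 0)] at h1
  simp only [sub_self, zero_mul, zero_add, iteratedDeriv_zetaApprox_one] at h1
  have h2 := ((Complex.continuous_ofReal.tendsto _).comp ((tendsto_stieltjesApprox k).comp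
    (tendsto_add_atTop_nat 1))).const_mul ((-1 : ℂ) ^ k) |>.const_mul ((k : ℂ) + 1)
  have h3 := tendsto_nhds_unique h1 h2
  have hk : (k : ℂ) + 1 ≠ 0 := by exact_mod_cast k.succ_ne_zero
  rw [generalizedStieltjes, mul_left_cancel₀ hk h3, ← mul_assoc, ← mul_pow]
  simp

theorem eulerStieltjes_zero : eulerStieltjes 0 = Real.eulerMascheroniConstant := by
  refine tendsto_nhds_unique (tendsto_stieltjesApprox 0)
    (Real.tendsto_harmonic_sub_log.congr fun n => ?_)
  simp [stieltjesApprox, harmonic_eq_sum_Icc]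

/-! ### Value and first derivative of the Hurwitz zeta function at 0. -/

/-- Partial sums of the series for `ζ(s, a) - ζ(s) + s (a - 1) ζ(s + 1)`, which converges on the
half plane `-1 < re s`. -/
noncomputable def lerchApprox (a : ℝ) (N : ℕ) (s : ℂ) : ℂ :=
  ∑ n ∈ Finset.range N, (((n + a : ℝ) : ℂ) ^ (-s) - ((n + 1 : ℝ) : ℂ) ^ (-s) +
    s * (a - 1) * ((n + 1 : ℝ) : ℂ) ^ (-s - 1))

theorem differentiable_lerchApprox {a : ℝ} (ha : 0 < a) (N : ℕ) :
    Differentiable ℂ (lerchApprox a N) := by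
  refine Differentiable.fun_sum fun n _ => ?_
  refine ((differentiable_ofReal_cpow (by positivity) (by fun_prop)).sub
    (differentiable_ofReal_cpow (by positivity) (by fun_prop))).add
    (Differentiable.mul (by fun_prop) (differentiable_ofReal_cpow (by positivity) (by fun_prop)))

theorem norm_lerchApprox_succ_sub_le {a : ℝ} (ha : 0 < a) (ha1 : a ≤ 1) (n : ℕ) {s : ℂ}
    (hs : -1 ≤ s.re) :
    ‖lerchApprox a (n + 1) s - lerchApprox a n s‖ ≤
      ‖s‖ * ‖s + 1‖ * (a * ((n : ℝ) + 1)) ^ (-2 - s.re) := by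
  have hb : 0 < a * ((n : ℝ) + 1) := by positivity
  have hn : (0 : ℝ) ≤ n := Nat.cast_nonneg n
  -- Since `a ≤ 1`, the number `a (n + 1)` lies below both `n + a` and `n + 1`, and it separates the
  -- dependence on `a` from that on `n`.
  have h := norm_ofReal_cpow_sub_sub_le (w := -s) (by simp; linarith)
    (b := a * ((n : ℝ) + 1)) (x := (n : ℝ) + 1) (y := (n : ℝ) + a) hb (by nlinarith) (by nlinarith)
  have e2 : (-s).re - 2 = -2 - s.re := by simp; ring
  rw [e2, norm_neg, show -s - 1 = -(s + 1) by ring, norm_neg] at h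
  calc _ = ‖((n + a : ℝ) : ℂ) ^ (-s) - ((n + 1 : ℝ) : ℂ) ^ (-s) -
        -s * ((n + 1 : ℝ) : ℂ) ^ (-(s + 1)) * (((n + a : ℝ) : ℂ) - ((n + 1 : ℝ) : ℂ))‖ := by
        congr 1
        unfold lerchApprox
        rw [Finset.sum_range_succ_sub_sum, neg_add']
        push_cast
        ring
    _ ≤ _ := h
    _ ≤ ‖s‖ * ‖s + 1‖ * (a * ((n : ℝ) + 1)) ^ (-2 - s.re) * 1 := by
        gcongr
        nlinarith
    _ = _ := mul_one _

theorem tendstoLocallyUniformlyOn_lerchApprox {a : ℝ} (ha : 0 < a) (ha1 : a ≤ 1) :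
    TendstoLocallyUniformlyOn (lerchApprox a)
      (fun s => HurwitzZeta.hurwitzZeta (a : UnitAddCircle) s - HurwitzZeta.hurwitzZeta 0 s +
        (a - 1) * (1 + s * hurwitzRegularPart 0 (1 + s))) atTop {s : ℂ | -1 < s.re} := by
  have hre : ∀ c : ℝ, IsOpen {s : ℂ | c < s.re} := fun c =>
    isOpen_lt continuous_const Complex.continuous_re
  refine tendstoLocallyUniformlyOn_of_norm_sub_le (V := {s : ℂ | 1 < s.re}) (hre (-1))
    (convex_halfSpace_re_gt (-1)).isPreconnected (hre 1) ⟨2, by simp⟩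
    (fun s (hs : 1 < s.re) => show -1 < s.re by linarith) (differentiable_lerchApprox ha) ?_ ?_ ?_
  · have h1 := differentiable_hurwitzRegularPart 0
    have h2 := HurwitzZeta.differentiable_hurwitzZeta_sub_hurwitzZeta (a : UnitAddCircle) 0
    exact (h2.add (by fun_prop)).differentiableOn
  · intro s hs
    rw [Set.mem_ofPred_eq] at hs
    have hs0 : s ≠ 0 := by rintro rfl; simp at hs; linarith
    have h1 : ((1 : ℝ) : UnitAddCircle) = 0 := AddCircle.coe_period 1
    -- The factor `1 + s R(1 + s)` is `s ζ(1 + s)` with its singularity at `s = 0` removed.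
    have e : (a - 1) * (1 + s * hurwitzRegularPart 0 (1 + s)) =
        s * (a - 1) * HurwitzZeta.hurwitzZeta ((1 : ℝ) : UnitAddCircle) (1 + s) := by
      rw [hurwitzRegularPart_of_ne (by simpa using hs0), h1, QuotientAddGroup.mk_zero, one_div,
        add_sub_cancel_left]
      linear_combination (1 - (a : ℂ)) * mul_inv_cancel₀ hs0
    rw [e, ← h1]
    have H := ((HurwitzZeta.hasSum_hurwitzZeta_of_one_lt_re (a := a) ⟨ha.le, ha1⟩ hs).sub
      (HurwitzZeta.hasSum_hurwitzZeta_of_one_lt_re (a := 1) (by simp) hs)).add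
      ((HurwitzZeta.hasSum_hurwitzZeta_of_one_lt_re (a := 1) (by simp) (s := 1 + s)
        (by simp; linarith)).mul_left (s * (a - 1)))
    refine H.tendsto_sum_nat.congr fun N => Finset.sum_congr rfl fun n _ => ?_
    rw [show -s - 1 = -(1 + s) by ring, Complex.cpow_neg, Complex.cpow_neg, Complex.cpow_neg,
      one_div, one_div, one_div]
    push_cast
    rfl
  · intro z hz
    rw [Set.mem_ofPred_eq] at hz
    -- The bound on `re s` is the midpoint of `-1` and `re z`.
    refine ⟨{s : ℂ | (z.re - 1) / 2 < s.re} ∩ Metric.ball z 1,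
      inter_mem ((hre _).mem_nhds (by simp; linarith)) (Metric.ball_mem_nhds z one_pos),
      fun n => (‖z‖ + 1) * (‖z‖ + 2) * (a ^ (-2 - (‖z‖ + 1)) *
        ((n : ℝ) + 1) ^ (-2 - (z.re - 1) / 2)),
      ((summable_nat_add_one_rpow (by linarith)).mul_left _).mul_left _, ?_⟩
    rintro n s ⟨hs1, hs2⟩
    rw [Set.mem_ofPred_eq] at hs1
    rw [mem_ball_iff_norm] at hs2
    have h1 : ‖s‖ ≤ ‖z‖ + 1 := by
      have := norm_add_le (s - z) z
      rw [sub_add_cancel] at this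
      linarith
    have h2 : ‖s + 1‖ ≤ ‖z‖ + 2 := by
      have := norm_add_le s 1
      rw [norm_one] at this
      linarith
    have h3 : s.re ≤ ‖z‖ + 1 := (Complex.re_le_norm s).trans h1
    refine (norm_lerchApprox_succ_sub_le ha ha1 n (by linarith)).trans ?_
    rw [Real.mul_rpow ha.le (by positivity)]
    have h4 : a ^ (-2 - s.re) ≤ a ^ (-2 - (‖z‖ + 1)) :=
      Real.rpow_le_rpow_of_exponent_ge ha ha1 (by linarith)
    have h5 : ((n : ℝ) + 1) ^ (-2 - s.re) ≤ ((n : ℝ) + 1) ^ (-2 - (z.re - 1) / 2) :=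
      Real.rpow_le_rpow_of_exponent_le (by linarith [(Nat.cast_nonneg n : (0 : ℝ) ≤ n)])
        (by linarith)
    dsimp only
    gcongr

/-- Every partial sum vanishes at `s = 0`, so the limit does too; there it equals `ζ(0, a) - ζ(0) +
(a - 1)`. -/
theorem hurwitzZeta_apply_zero {a : ℝ} (ha : 0 < a) (ha1 : a ≤ 1) :
    HurwitzZeta.hurwitzZeta (a : UnitAddCircle) 0 = 1 / 2 - a := by
  have h1 := (tendstoLocallyUniformlyOn_lerchApprox ha ha1).tendsto_at (a := 0) (by simp)
  have h2 : ∀ N, lerchApprox a N 0 = 0 := fun N => by simp [lerchApprox]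
  simp only [h2] at h1
  have h3 := tendsto_nhds_unique h1 tendsto_const_nhds
  rw [HurwitzZeta.hurwitzZeta_zero, riemannZeta_zero] at h3
  linear_combination h3

theorem deriv_lerchApprox_zero {a : ℝ} (ha : 0 < a) (N : ℕ) :
    deriv (lerchApprox a N) 0 = ((∑ n ∈ Finset.range N,
      (-Real.log (n + a) + Real.log (n + 1) + (a - 1) * ((n : ℝ) + 1)⁻¹) : ℝ) : ℂ) := by
  have hd : ∀ {x : ℝ}, 0 < x → HasDerivAt (fun s : ℂ => (x : ℂ) ^ (-s)) (-(Real.log x : ℂ)) 0 := by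
    intro x hx
    have h := (differentiable_ofReal_cpow hx differentiable_neg 0).hasDerivAt
    rw [← iteratedDeriv_one, iteratedDeriv_ofReal_cpow_neg hx] at h
    simpa using h
  have : HasDerivAt (lerchApprox a N) (∑ n ∈ Finset.range N,
      (-(Real.log (n + a) : ℂ) - -(Real.log (n + 1) : ℂ) + (a - 1) * ((n + 1 : ℝ) : ℂ)⁻¹)) 0 := by
    refine HasDerivAt.fun_sum fun n _ => ?_
    refine ((hd (by positivity)).sub (hd (by positivity))).add ?_
    have h1 : DifferentiableAt ℂ (fun s : ℂ => ((n + 1 : ℝ) : ℂ) ^ (-s - 1)) 0 :=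
      differentiable_ofReal_cpow (by positivity) (by fun_prop) 0
    have h2 := ((hasDerivAt_id (0 : ℂ)).mul_const ((a : ℂ) - 1)).mul h1.hasDerivAt
    refine h2.congr_deriv ?_
    simp [Complex.cpow_neg_one]
  rw [this.deriv]
  push_cast
  refine Finset.sum_congr rfl fun n _ => ?_
  ring

/-- The sum of `n + 1` terms is the Bohr-Mollerup sequence for `log Γ(a)`, plus `a - 1` times
`H_(n+1) - log(n+1)`, plus `a (log(n+1) - log n)`, which tends to 0. -/
theorem tendsto_deriv_lerchApprox_zero {a : ℝ} (ha : 0 < a) :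
    Tendsto (fun N : ℕ => ∑ n ∈ Finset.range N,
      (-Real.log (n + a) + Real.log (n + 1) + (a - 1) * ((n : ℝ) + 1)⁻¹)) atTop
      (𝓝 (Real.log (Real.Gamma a) + (a - 1) * Real.eulerMascheroniConstant)) := by
  have h1 := Real.BohrMollerup.tendsto_log_gamma ha
  have h2 := (Real.tendsto_harmonic_sub_log.comp (tendsto_add_atTop_nat 1)).const_mul (a - 1)
  have h3 := Real.tendsto_log_nat_add_one_sub_log.const_mul a
  rw [← tendsto_add_atTop_iff_nat 1]
  have h := (h1.add h2).add h3
  rw [mul_zero, add_zero] at h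
  refine h.congr fun n => ?_
  have hfac : ∀ m : ℕ, ∑ k ∈ Finset.range m, Real.log ((k : ℝ) + 1) =
      Real.log (m.factorial : ℝ) := by
    intro m
    induction m with
    | zero => simp
    | succ m ih =>
      rw [Finset.sum_range_succ, ih, Nat.factorial_succ, Nat.cast_mul,
        Real.log_mul (by positivity) (by positivity)]
      push_cast
      ring
  have hH : ((harmonic (n + 1) : ℚ) : ℝ) = ∑ k ∈ Finset.range (n + 1), ((k : ℝ) + 1)⁻¹ := by
    simp [harmonic]
  have hl : Real.log ((n + 1).factorial : ℝ) = Real.log (n + 1) + Real.log (n.factorial : ℝ) := by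
    rw [Nat.factorial_succ, Nat.cast_mul, Real.log_mul (by positivity) (by positivity)]
    push_cast
    ring
  rw [Finset.sum_add_distrib, Finset.sum_add_distrib, Finset.sum_neg_distrib, hfac,
    ← Finset.mul_sum, ← hH, hl, Function.comp_apply, Real.BohrMollerup.logGammaSeq]
  simp only [add_comm a]
  push_cast
  ring

/-- Lerch's formula, up to the constant `ζ'(0)`. -/
theorem hurwitzDerivZero_one {a : ℝ} (ha : 0 < a) (ha1 : a ≤ 1) :
    hurwitzDerivZero 1 a = Real.log (Real.Gamma a) + deriv riemannZeta 0 := by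
  have h1 := ((tendstoLocallyUniformlyOn_lerchApprox ha ha1).deriv
    (Eventually.of_forall fun n => (differentiable_lerchApprox ha n).differentiableOn)
    (isOpen_lt continuous_const Complex.continuous_re)).tendsto_at (a := 0) (by simp)
  simp only [Function.comp_apply, deriv_lerchApprox_zero ha] at h1
  have h2 := tendsto_nhds_unique h1 ((Complex.continuous_ofReal.tendsto _).comp
    (tendsto_deriv_lerchApprox_zero ha))
  have hR := differentiable_hurwitzRegularPart 0
  have hz := (HurwitzZeta.differentiableAt_hurwitzZeta (a : UnitAddCircle)
    (zero_ne_one' ℂ)).hasDerivAt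
  have hz0 := (differentiableAt_riemannZeta (zero_ne_one' ℂ)).hasDerivAt
  have h3 : HasDerivAt (fun s => HurwitzZeta.hurwitzZeta (a : UnitAddCircle) s -
      HurwitzZeta.hurwitzZeta 0 s + (a - 1) * (1 + s * hurwitzRegularPart 0 (1 + s)))
      (deriv (HurwitzZeta.hurwitzZeta (a : UnitAddCircle)) 0 - deriv riemannZeta 0 +
        (a - 1) * hurwitzRegularPart 0 1) 0 := by
    rw [HurwitzZeta.hurwitzZeta_zero]
    refine (hz.sub hz0).add (HasDerivAt.const_mul _ (HasDerivAt.const_add _ ?_))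
    have h4 : DifferentiableAt ℂ (fun s => hurwitzRegularPart 0 (1 + s)) 0 := by fun_prop
    refine ((hasDerivAt_id (0 : ℂ)).mul h4.hasDerivAt).congr_deriv ?_
    simp
  have h5 : hurwitzRegularPart 0 1 = Real.eulerMascheroniConstant := by
    have := generalizedStieltjes_zero_right 0
    rw [eulerStieltjes_zero] at this
    simpa [generalizedStieltjes] using this
  rw [h3.deriv, h5] at h2
  rw [hurwitzDerivZero, iteratedDeriv_one]
  push_cast at h2
  linear_combination h2

/-! ### Hurwitz's formula at rational arguments. -/

theorem ZMod.sum_univ_eq_sum_range {M : Type*} [AddCommMonoid M] (q : ℕ) [NeZero q]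
    (f : ZMod q → M) : ∑ x, f x = ∑ k ∈ Finset.range q, f (k : ZMod q) := by
  refine (Finset.sum_nbij' (fun k : ℕ => (k : ZMod q)) ZMod.val ?_ ?_ ?_ ?_ ?_).symm
  · simp
  · exact fun x _ => Finset.mem_range.mpr (ZMod.val_lt x)
  · exact fun k hk => ZMod.val_cast_of_lt (Finset.mem_range.mp hk)
  · exact fun x _ => ZMod.natCast_zmod_val x
  · simp

/-- The left side is the L-function of an additive character mod `q`; splitting it into residue
classes gives Hurwitz zeta functions. -/
theorem expZeta_natCast_div (q : ℕ) [NeZero q] (j : ℤ) {s : ℂ} (hs : s ≠ 1) :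
    HurwitzZeta.expZeta (((j : ℝ) / q : ℝ) : UnitAddCircle) s = (q : ℂ) ^ (-s) *
      ∑ k ∈ Finset.range q, Complex.exp (2 * Real.pi * Complex.I * (j * k / q)) *
        HurwitzZeta.hurwitzZeta (((k : ℝ) / q : ℝ) : UnitAddCircle) s := by
  have h := ZMod.LFunction_stdAddChar_eq_expZeta (N := q) (j : ZMod q) s (Or.inr hs)
  rw [ZMod.toAddCircle_intCast] at h
  rw [← h, ZMod.LFunction, ZMod.sum_univ_eq_sum_range]
  congr 1
  refine Finset.sum_congr rfl fun k _ => ?_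
  rw [ZMod.toAddCircle_natCast]
  congr 1
  have := ZMod.stdAddChar_coe (N := q) (j * k)
  push_cast at this
  rw [this]
  congr 1
  ring

theorem hurwitzZeta_natCast_div_one_sub {r q : ℕ} (hr : 0 < r) (hrq : r < q) {s : ℂ}
    (hs : ∀ n : ℕ, s ≠ -n) (hs1 : s ≠ 1) :
    HurwitzZeta.hurwitzZeta (((r : ℝ) / q : ℝ) : UnitAddCircle) (1 - s) =
      (2 * Real.pi) ^ (-s) * (q : ℂ) ^ (-s) * Complex.Gamma s *
      (2 * ∑ k ∈ Finset.range q,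
        (Complex.cos (Real.pi * s / 2) * Real.cos (2 * Real.pi * r * k / q) +
          Complex.sin (Real.pi * s / 2) * Real.sin (2 * Real.pi * r * k / q)) *
        HurwitzZeta.hurwitzZeta (((k : ℝ) / q : ℝ) : UnitAddCircle) s) := by
  have : NeZero q := ⟨by omega⟩
  have h1 := expZeta_natCast_div q r hs1
  have h2 := expZeta_natCast_div q (-r) hs1
  push_cast at h1 h2
  rw [HurwitzZeta.hurwitzZeta_one_sub _ hs (Or.inr hs1), ← QuotientAddGroup.mk_neg,
    ← neg_div]
  rw [h1, h2]
  set S₁ := ∑ k ∈ Finset.range q, Complex.exp (2 * Real.pi * Complex.I * (r * k / q)) *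
    HurwitzZeta.hurwitzZeta (((k : ℝ) / q : ℝ) : UnitAddCircle) s with hS₁
  set S₂ := ∑ k ∈ Finset.range q, Complex.exp (2 * Real.pi * Complex.I * (-r * k / q)) *
    HurwitzZeta.hurwitzZeta (((k : ℝ) / q : ℝ) : UnitAddCircle) s with hS₂
  have key : Complex.exp (-Real.pi * Complex.I * s / 2) * S₁ +
      Complex.exp (Real.pi * Complex.I * s / 2) * S₂ = 2 * ∑ k ∈ Finset.range q,
        (Complex.cos (Real.pi * s / 2) * Real.cos (2 * Real.pi * r * k / q) +
          Complex.sin (Real.pi * s / 2) * Real.sin (2 * Real.pi * r * k / q)) *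
        HurwitzZeta.hurwitzZeta (((k : ℝ) / q : ℝ) : UnitAddCircle) s := by
    rw [hS₁, hS₂, Finset.mul_sum, Finset.mul_sum, Finset.mul_sum, ← Finset.sum_add_distrib]
    refine Finset.sum_congr rfl fun k _ => ?_
    rw [← mul_assoc, ← mul_assoc, ← mul_assoc, ← add_mul, ← Complex.exp_add, ← Complex.exp_add]
    congr 1
    push_cast
    rw [← Complex.cos_sub, Complex.two_cos, add_comm]
    congr 2 <;> ring
  linear_combination (2 * (Real.pi : ℂ)) ^ (-s) * (q : ℂ) ^ (-s) * Complex.Gamma s * key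

theorem hurwitzDerivZero_one_eq {a : ℝ} (ha : 0 < a) (ha1 : a ≤ 1) :
    hurwitzDerivZero 1 a =
      ((Real.log (Real.Gamma a) - Real.log (2 * Real.pi) / 2 : ℝ) : ℂ) := by
  have : (0 : ℝ) ≤ 2 * Real.pi := by positivity
  rw [hurwitzDerivZero_one ha ha1, deriv_riemannZeta_zero]
  rw [Complex.ofReal_sub, Complex.ofReal_div, Complex.ofReal_log this]
  push_cast
  ring

/-! ### Finite trigonometric sums. -/

theorem four_mul_sin_sq_mul_sum_range_mul_sin (θ : ℝ) (n : ℕ) :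
    4 * Real.sin (θ / 2) ^ 2 * ∑ l ∈ Finset.range (n + 1), (l : ℝ) * Real.sin (l * θ) =
      (n + 1) * Real.sin (n * θ) - n * Real.sin ((n + 1) * θ) := by
  induction n with
  | zero => simp
  | succ n ih =>
    have h2 : 2 * Real.sin (θ / 2) ^ 2 = 1 - Real.cos θ := by
      have h := Real.cos_sq' (θ / 2)
      have h' := Real.cos_two_mul (θ / 2)
      rw [mul_div_cancel₀ θ two_ne_zero] at h'
      linarith
    rw [Finset.sum_range_succ, mul_add, ih]
    push_cast
    have e1 : ((n : ℝ) + 1 + 1) * θ = (n + 1) * θ + θ := by ring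
    have e2 : (n : ℝ) * θ = (n + 1) * θ - θ := by ring
    rw [e1, e2, Real.sin_add, Real.sin_sub]
    linear_combination 2 * ((n : ℝ) + 1) * Real.sin ((n + 1) * θ) * h2

section TrigSums

variable {r q : ℕ}

theorem sin_pi_mul_div_pos {l : ℕ} (hl : 0 < l) (hlq : l < q) :
    0 < Real.sin (Real.pi * l / q) := by
  have hq : (0 : ℝ) < q := by exact_mod_cast hl.trans hlq
  have hl' : (0 : ℝ) < l := by exact_mod_cast hl
  have hlq' : (l : ℝ) < q := by exact_mod_cast hlq
  refine Real.sin_pos_of_pos_of_lt_pi (by positivity) ?_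
  rw [div_lt_iff₀ hq]
  exact mul_lt_mul_of_pos_left hlq' Real.pi_pos

theorem sum_Ico_reflect_of_sub {M : Type*} [AddCommMonoid M] (f : ℕ → M) :
    ∑ l ∈ Finset.Ico 1 q, f (q - l) = ∑ l ∈ Finset.Ico 1 q, f l := by
  refine Finset.sum_nbij' (fun l => q - l) (fun l => q - l) ?_ ?_ ?_ ?_ ?_ <;>
    simp only [Finset.mem_Ico] <;> intros <;> first | omega | trivial

theorem cos_mul_sub_div {l : ℕ} (hl : l ∈ Finset.Ico 1 q) :
    Real.cos (2 * Real.pi * r * (q - l : ℕ) / q) = Real.cos (2 * Real.pi * r * l / q) := by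
  rw [Finset.mem_Ico] at hl
  have hq : (q : ℝ) ≠ 0 := by exact_mod_cast (show q ≠ 0 by omega)
  rw [Nat.cast_sub hl.2.le, ← Real.cos_nat_mul_two_pi_sub _ r]
  congr 1
  field_simp
  ring

theorem sin_mul_sub_div {l : ℕ} (hl : l ∈ Finset.Ico 1 q) :
    Real.sin (2 * Real.pi * r * (q - l : ℕ) / q) = -Real.sin (2 * Real.pi * r * l / q) := by
  rw [Finset.mem_Ico] at hl
  have hq : (q : ℝ) ≠ 0 := by exact_mod_cast (show q ≠ 0 by omega)
  rw [Nat.cast_sub hl.2.le, ← Real.sin_nat_mul_two_pi_sub _ r]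
  congr 1
  field_simp

theorem sum_sin_two_pi_mul_div :
    ∑ l ∈ Finset.Ico 1 q, Real.sin (2 * Real.pi * r * l / q) = 0 := by
  have h := sum_Ico_reflect_of_sub (q := q) (fun l => Real.sin (2 * Real.pi * r * l / q))
  rw [Finset.sum_congr rfl fun l hl => sin_mul_sub_div hl, Finset.sum_neg_distrib] at h
  linarith

theorem sum_cos_two_pi_mul_div (hr : 0 < r) (hrq : r < q) :
    ∑ l ∈ Finset.Ico 1 q, Real.cos (2 * Real.pi * r * l / q) = -1 := by
  have hp : IsPrimitiveRoot (Complex.exp (2 * Real.pi * Complex.I / q)) q :=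
    Complex.isPrimitiveRoot_exp q (by omega)
  have h1 : Complex.exp (2 * Real.pi * Complex.I / q) ^ r ≠ 1 := by
    intro h
    have := Nat.le_of_dvd hr ((hp.pow_eq_one_iff_dvd r).mp h)
    omega
  have h2 : ∑ l ∈ Finset.range q, (Complex.exp (2 * Real.pi * Complex.I / q) ^ r) ^ l = 0 := by
    have h3 := mul_geom_sum (Complex.exp (2 * Real.pi * Complex.I / q) ^ r) q
    rw [← pow_mul, mul_comm r, pow_mul, hp.pow_eq_one, one_pow, sub_self] at h3
    exact (mul_eq_zero.mp h3).resolve_left (sub_ne_zero.mpr h1)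
  have h4 : ∀ l : ℕ, ((Complex.exp (2 * Real.pi * Complex.I / q) ^ r) ^ l).re =
      Real.cos (2 * Real.pi * r * l / q) := by
    intro l
    rw [← pow_mul, ← Complex.exp_nat_mul, ← Complex.exp_ofReal_mul_I_re]
    congr 2
    push_cast
    ring
  have h5 := congrArg Complex.re h2
  rw [Complex.re_sum, Finset.sum_congr rfl fun l _ => h4 l, Finset.range_eq_Ico,
    Finset.sum_eq_sum_Ico_succ_bot (by omega)] at h5
  simp at h5
  linarith

/-- The reflection `l ↦ q - l` fixes the cosine and negates `1/2 - l/q`. -/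
theorem sum_cos_mul_natCast (hq0 : 0 < q) :
    ∑ l ∈ Finset.Ico 1 q, Real.cos (2 * Real.pi * r * l / q) * (1 / 2 - (l : ℝ) / q) = 0 := by
  have h := sum_Ico_reflect_of_sub (q := q)
    (fun l => Real.cos (2 * Real.pi * r * l / q) * (1 / 2 - (l : ℝ) / q))
  have hq : (q : ℝ) ≠ 0 := by positivity
  rw [Finset.sum_congr rfl fun l hl => by
    rw [cos_mul_sub_div hl, Nat.cast_sub (Finset.mem_Ico.mp hl).2.le, sub_div, div_self hq,
      show Real.cos (2 * Real.pi * r * l / q) * (1 / 2 - (1 - (l : ℝ) / q)) =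
      -(Real.cos (2 * Real.pi * r * l / q) * (1 / 2 - (l : ℝ) / q)) by ring],
    Finset.sum_neg_distrib] at h
  linarith

/-- Pairing `l` with `q - l`, the reflection formula for `Γ` turns each pair of brackets into `-log
2 - log sin(πl/q)`; the cosines sum to `-1`. -/
theorem sum_cos_mul_log_Gamma (hr : 0 < r) (hrq : r < q) :
    ∑ l ∈ Finset.Ico 1 q, Real.cos (2 * Real.pi * r * l / q) *
        (Real.log (Real.Gamma ((l : ℝ) / q)) - Real.log (2 * Real.pi) / 2) =
      (Real.log 2 - ∑ l ∈ Finset.Ico 1 q,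
        Real.cos (2 * Real.pi * r * l / q) * Real.log (Real.sin (Real.pi * l / q))) / 2 := by
  have hq : (0 : ℝ) < q := by exact_mod_cast hr.trans hrq
  have h := sum_Ico_reflect_of_sub (q := q) (fun l => Real.cos (2 * Real.pi * r * l / q) *
        (Real.log (Real.Gamma ((l : ℝ) / q)) - Real.log (2 * Real.pi) / 2))
  have h2 : ∀ l ∈ Finset.Ico 1 q,
      Real.cos (2 * Real.pi * r * (q - l : ℕ) / q) *
        (Real.log (Real.Gamma (((q - l : ℕ) : ℝ) / q)) - Real.log (2 * Real.pi) / 2) +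
      Real.cos (2 * Real.pi * r * l / q) *
        (Real.log (Real.Gamma ((l : ℝ) / q)) - Real.log (2 * Real.pi) / 2) =
      -Real.log 2 * Real.cos (2 * Real.pi * r * l / q) -
        Real.cos (2 * Real.pi * r * l / q) * Real.log (Real.sin (Real.pi * l / q)) := by
    intro l hl
    rw [cos_mul_sub_div hl]
    rw [Finset.mem_Ico] at hl
    have hl0 : (0 : ℝ) < l := by exact_mod_cast hl.1
    have hlq : (l : ℝ) < q := by exact_mod_cast hl.2
    have hG := Real.Gamma_mul_Gamma_one_sub ((l : ℝ) / q)
    have hG1 : 0 < Real.Gamma ((l : ℝ) / q) := Real.Gamma_pos_of_pos (by positivity)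
    have hG2 : 0 < Real.Gamma (1 - (l : ℝ) / q) :=
      Real.Gamma_pos_of_pos (sub_pos.mpr ((div_lt_one hq).mpr hlq))
    have hs := sin_pi_mul_div_pos hl.1 hl.2
    have hlog := congrArg Real.log hG
    rw [Real.log_mul hG1.ne' hG2.ne', ← mul_div_assoc, Real.log_div Real.pi_ne_zero hs.ne'] at hlog
    rw [Nat.cast_sub hl.2.le, sub_div, div_self hq.ne', Real.log_mul two_ne_zero Real.pi_ne_zero]
    linear_combination Real.cos (2 * Real.pi * r * l / q) * hlog
  have h3 := Finset.sum_congr rfl h2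
  rw [Finset.sum_add_distrib, h, Finset.sum_sub_distrib, ← Finset.mul_sum,
    sum_cos_two_pi_mul_div hr hrq] at h3
  linarith

theorem sum_sin_mul_natCast (hr : 0 < r) (hrq : r < q) :
    ∑ l ∈ Finset.Ico 1 q, Real.sin (2 * Real.pi * r * l / q) * (1 / 2 - (l : ℝ) / q) =
      Real.cot (Real.pi * r / q) / 2 := by
  have hq : (q : ℝ) ≠ 0 := by exact_mod_cast (show q ≠ 0 by omega)
  obtain ⟨n, rfl⟩ : ∃ n, q = n + 1 := ⟨q - 1, by omega⟩
  have hs := sin_pi_mul_div_pos hr hrq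
  have h := four_mul_sin_sq_mul_sum_range_mul_sin (2 * (Real.pi * r / (n + 1 : ℕ))) n
  -- With `θ = 2πr/q` and `n = q - 1`, `nθ` is `-θ` modulo `2π` and `sin((n+1)θ) = 0`, so the closed
  -- form collapses to a multiple of `sin θ`.
  have e1 : (n : ℝ) * (2 * (Real.pi * r / (n + 1 : ℕ))) =
      (r : ℝ) * (2 * Real.pi) - 2 * (Real.pi * r / (n + 1 : ℕ)) := by
    push_cast at hq ⊢
    field_simp
    ring
  have e2 : ((n : ℝ) + 1) * (2 * (Real.pi * r / (n + 1 : ℕ))) = (2 * r : ℕ) * Real.pi := by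
    push_cast at hq ⊢
    field_simp
  rw [e1, e2, Real.sin_nat_mul_two_pi_sub, Real.sin_nat_mul_pi, mul_div_cancel_left₀ _ two_ne_zero,
    Real.sin_two_mul] at h
  have h5 : ∑ l ∈ Finset.Ico 1 (n + 1), Real.sin (2 * Real.pi * r * l / (n + 1 : ℕ)) *
      (1 / 2 - (l : ℝ) / (n + 1 : ℕ)) = -(∑ l ∈ Finset.range (n + 1),
        (l : ℝ) * Real.sin (l * (2 * (Real.pi * r / (n + 1 : ℕ))))) / (n + 1 : ℕ) := by
    rw [Finset.range_eq_Ico, Finset.sum_eq_sum_Ico_succ_bot (by omega : 0 < n + 1)]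
    simp only [mul_sub, Finset.sum_sub_distrib, ← Finset.sum_mul, sum_sin_two_pi_mul_div]
    rw [Nat.cast_zero, zero_mul, zero_mul, zero_add, zero_sub, zero_add, neg_div, Finset.sum_div]
    congr 1
    refine Finset.sum_congr rfl fun l _ => ?_
    rw [show (l : ℝ) * (2 * (Real.pi * r / (n + 1 : ℕ))) =
      2 * Real.pi * r * l / (n + 1 : ℕ) by ring]
    ring
  rw [h5, Real.cot_eq_cos_div_sin]
  set S := ∑ l ∈ Finset.range (n + 1),
        (l : ℝ) * Real.sin (l * (2 * (Real.pi * r / (n + 1 : ℕ))))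
  have hs' := hs.ne'
  rw [div_div, div_eq_div_iff hq (by positivity)]
  have hq' : ((n + 1 : ℕ) : ℝ) = n + 1 := by push_cast; ring
  refine mul_left_cancel₀ (mul_ne_zero two_ne_zero hs') ?_
  rw [← hq'] at h
  linear_combination (-1 : ℝ) * h

end TrigSums

/-! ### Calculus of third-order expansions. -/

/-- `f x = a + b x + c x ^ 2 + d x ^ 3 + O(x ^ 4)` as `x → 0`, `x ≠ 0`. -/
def HasCubicExpansion (f : ℂ → ℂ) (a b c d : ℂ) : Prop :=
  (fun x => f x - (a + b * x + c * x ^ 2 + d * x ^ 3)) =O[𝓝[≠] 0] fun x => x ^ 4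

namespace HasCubicExpansion

variable {f g : ℂ → ℂ} {a b c d a' b' c' d' : ℂ}

theorem congr (hf : HasCubicExpansion f a b c d) (h : ∀ᶠ x in 𝓝[≠] 0, f x = g x) :
    HasCubicExpansion g a b c d :=
  Asymptotics.IsBigO.congr' hf (h.mono fun x hx => by simp only [hx]) EventuallyEq.rfl

theorem congr_coeff (hf : HasCubicExpansion f a b c d) (ha : a = a') (hb : b = b') (hc : c = c')
    (hd : d = d') : HasCubicExpansion f a' b' c' d' := by
  subst ha hb hc hd
  exact hf

theorem add (hf : HasCubicExpansion f a b c d) (hg : HasCubicExpansion g a' b' c' d') :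
    HasCubicExpansion (fun x => f x + g x) (a + a') (b + b') (c + c') (d + d') :=
  (Asymptotics.IsBigO.add hf hg).congr_left fun x => by ring

theorem const (k : ℂ) : HasCubicExpansion (fun _ => k) k 0 0 0 :=
  (Asymptotics.isBigO_zero _ _).congr_left fun x => by ring

theorem id : HasCubicExpansion (fun x => x) 0 1 0 0 :=
  (Asymptotics.isBigO_zero _ _).congr_left fun x => by ring

theorem isBigO_one_of_continuous {p : ℂ → ℂ} (hp : Continuous p) :
    p =O[𝓝[≠] 0] fun _ => (1 : ℂ) :=
  ((hp.tendsto 0).mono_left nhdsWithin_le_nhds).isBigO_one ℂ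

theorem isBigO_one (hf : HasCubicExpansion f a b c d) : f =O[𝓝[≠] 0] fun _ => (1 : ℂ) := by
  exact ((Asymptotics.IsBigO.trans hf (isBigO_one_of_continuous (by fun_prop))).add
      (isBigO_one_of_continuous (p := fun x => a + b * x + c * x ^ 2 + d * x ^ 3)
        (by fun_prop))).congr_left fun x => by ring

theorem mul (hf : HasCubicExpansion f a b c d) (hg : HasCubicExpansion g a' b' c' d') :
    HasCubicExpansion (fun x => f x * g x) (a * a') (a * b' + b * a') (a * c' + b * b' + c * a')
      (a * d' + b * c' + c * b' + d * a') := by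
  have h1 := Asymptotics.IsBigO.mul hf hg.isBigO_one
  have h2 := (isBigO_one_of_continuous (p := fun x => a + b * x + c * x ^ 2 + d * x ^ 3)
    (by fun_prop)).mul hg
  have h3 := (isBigO_one_of_continuous (p := fun x => (b * d' + c * c' + d * b') +
    (c * d' + d * c') * x + d * d' * x ^ 2) (by fun_prop)).mul
    (Asymptotics.isBigO_refl (fun x : ℂ => x ^ 4) (𝓝[≠] 0))
  simp only [one_mul, mul_one] at h1 h2 h3
  exact ((h1.add h2).add h3).congr_left fun x => by ring

theorem const_mul (k : ℂ) (hf : HasCubicExpansion f a b c d) :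
    HasCubicExpansion (fun x => k * f x) (k * a) (k * b) (k * c) (k * d) :=
  ((const k).mul hf).congr_coeff (by ring) (by ring) (by ring) (by ring)

theorem sum {ι : Type*} {s : Finset ι} {f : ι → ℂ → ℂ} {a b c d : ι → ℂ}
    (h : ∀ i ∈ s, HasCubicExpansion (f i) (a i) (b i) (c i) (d i)) :
    HasCubicExpansion (fun x => ∑ i ∈ s, f i x) (∑ i ∈ s, a i) (∑ i ∈ s, b i) (∑ i ∈ s, c i)
      (∑ i ∈ s, d i) := by
  classical
  induction s using Finset.induction_on with
  | empty => simpa using const 0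
  | insert i s hi ih =>
    simp only [Finset.sum_insert hi]
    exact (h i (Finset.mem_insert_self i s)).add
      (ih fun j hj => h j (Finset.mem_insert_of_mem hj))

theorem comp_neg (hf : HasCubicExpansion f a b c d) :
    HasCubicExpansion (fun x => f (-x)) a (-b) c (-d) := by
  have ht : Tendsto (fun x : ℂ => -x) (𝓝[≠] 0) (𝓝[≠] 0) := by
    refine tendsto_nhdsWithin_iff.mpr ⟨?_, ?_⟩
    · simpa using (continuous_neg.tendsto (0 : ℂ)).mono_left nhdsWithin_le_nhds
    · filter_upwards [self_mem_nhdsWithin] with x hx using neg_ne_zero.mpr hx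
  refine ((Asymptotics.IsBigO.comp_tendsto hf ht).congr (fun x => ?_) fun x => ?_)
  · simp only [Function.comp_apply]
    ring
  · simp only [Function.comp_apply]
    ring

/-- One step of coefficient comparison: let `x → 0` to kill `a`, then divide by `x`. -/
theorem eq_zero_and_isBigO_of_isBigO {p : ℂ → ℂ} (hp : Continuous p) {n : ℕ}
    (h : (fun x => a + x * p x) =O[𝓝[≠] 0] fun x => x ^ (n + 1)) :
    a = 0 ∧ p =O[𝓝[≠] 0] fun x => x ^ n := by
  have h0 : Tendsto (fun x : ℂ => x ^ (n + 1)) (𝓝[≠] 0) (𝓝 0) := by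
    have : Continuous fun x : ℂ => x ^ (n + 1) := by fun_prop
    simpa using (this.tendsto 0).mono_left nhdsWithin_le_nhds
  have h1 : Tendsto (fun x => a + x * p x) (𝓝[≠] 0) (𝓝 a) := by
    have : Continuous fun x => a + x * p x := by fun_prop
    simpa using (this.tendsto 0).mono_left nhdsWithin_le_nhds
  have ha : a = 0 := tendsto_nhds_unique h1 (h.trans_tendsto h0)
  subst ha
  refine ⟨rfl, ?_⟩
  have h2 := h.mul (Asymptotics.isBigO_refl (fun x : ℂ => x⁻¹) (𝓝[≠] 0))
  refine h2.congr' ?_ ?_ <;> filter_upwards [self_mem_nhdsWithin] with x hx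
  · have hx' : x ≠ 0 := hx
    field_simp
    ring
  · have hx' : x ≠ 0 := hx
    field_simp
    ring

theorem unique (hf : HasCubicExpansion f a b c d) (hg : HasCubicExpansion f a' b' c' d') :
    a = a' ∧ b = b' ∧ c = c' ∧ d = d' := by
  have h := Asymptotics.IsBigO.sub hg hf
  -- Horner form, ending in `x * 0`, lets the same step peel off all four coefficients.
  obtain ⟨h0, h1⟩ := eq_zero_and_isBigO_of_isBigO (a := a - a')
    (p := fun x => (b - b') + x * ((c - c') + x * ((d - d') + x * 0))) (by fun_prop) (n := 3)
    (h.congr_left fun x => by ring)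
  obtain ⟨h1, h2⟩ := eq_zero_and_isBigO_of_isBigO (by fun_prop) h1
  obtain ⟨h2, h3⟩ := eq_zero_and_isBigO_of_isBigO (by fun_prop) h2
  obtain ⟨h3, -⟩ := eq_zero_and_isBigO_of_isBigO (p := fun _ => 0) (by fun_prop) h3
  exact ⟨sub_eq_zero.mp h0, sub_eq_zero.mp h1, sub_eq_zero.mp h2, sub_eq_zero.mp h3⟩

theorem of_analyticAt (hf : AnalyticAt ℂ f 0) :
    HasCubicExpansion f (f 0) (deriv f 0) (iteratedDeriv 2 f 0 / 2) (iteratedDeriv 3 f 0 / 6) := by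
  have h := (hf.hasFPowerSeriesAt.isBigO_sub_partialSum_pow 4).mono
    (nhdsWithin_le_nhds (s := {0}ᶜ))
  refine (h.congr_left fun x => ?_).trans ?_
  · simp [FormalMultilinearSeries.partialSum, Finset.sum_range_succ, Nat.factorial,
      iteratedDeriv_one]
    ring
  · exact Asymptotics.isBigO_of_le _ fun x => by simp

theorem cexp_const_mul (k : ℂ) :
    HasCubicExpansion (fun x => Complex.exp (k * x)) 1 k (k ^ 2 / 2) (k ^ 3 / 6) := by
  have h : AnalyticAt ℂ (fun x => Complex.exp (k * x)) 0 :=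
    Differentiable.analyticAt (by fun_prop) 0
  refine (of_analyticAt h).congr_coeff (by simp) ?_ ?_ ?_
  · rw [← iteratedDeriv_one, iteratedDeriv_cexp_const_mul]; simp
  · rw [iteratedDeriv_cexp_const_mul]; simp
  · rw [iteratedDeriv_cexp_const_mul]; simp

theorem cos_const_mul (k : ℂ) :
    HasCubicExpansion (fun x => Complex.cos (k * x)) 1 0 (-(k ^ 2) / 2) 0 := by
  have h := ((cexp_const_mul (k * Complex.I)).add (cexp_const_mul (-(k * Complex.I)))).const_mul
    (1 / 2)
  refine (h.congr (Eventually.of_forall fun x => ?_)).congr_coeff (by ring) (by ring) ?_ (by ring)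
  · rw [Complex.cos]; ring_nf
  · linear_combination k ^ 2 / 2 * Complex.I_sq

theorem sin_const_mul (k : ℂ) :
    HasCubicExpansion (fun x => Complex.sin (k * x)) 0 k 0 (-(k ^ 3) / 6) := by
  have h := ((cexp_const_mul (-(k * Complex.I))).add
    ((cexp_const_mul (k * Complex.I)).const_mul (-1))).const_mul (Complex.I / 2)
  refine (h.congr (Eventually.of_forall fun x => ?_)).congr_coeff (by ring) ?_ (by ring) ?_
  · rw [Complex.sin]; ring_nf
  · linear_combination -k * Complex.I_sq
  · linear_combination (-(k ^ 3) / 6) * (Complex.I ^ 2 - 1) * Complex.I_sq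

end HasCubicExpansion

/-! ### Expansions of the Gamma and zeta factors. -/

theorem ne_neg_natCast_of_norm_lt_one {x : ℂ} (hx : x ≠ 0) (hx1 : ‖x‖ < 1) (n : ℕ) :
    x ≠ -n := by
  rintro rfl
  rw [norm_neg, Complex.norm_natCast] at hx1
  have : n = 0 := by
    have : n < 1 := by exact_mod_cast hx1
    omega
  simp [this] at hx

theorem eventually_ne_zero_and_norm_lt_one : ∀ᶠ x : ℂ in 𝓝[≠] 0, x ≠ 0 ∧ ‖x‖ < 1 := by
  filter_upwards [self_mem_nhdsWithin,
    mem_nhdsWithin_of_mem_nhds (Metric.ball_mem_nhds (0 : ℂ) one_pos)] with x hx hx1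
  exact ⟨hx, by simpa using hx1⟩

/-- The quadratic coefficient is forced by `Γ(1+x) Γ(1-x) sin(πx) = πx`. The cubic one may stay
unspecified: in the application `Γ(1+x)` multiplies a factor that is `O(x)`. -/
theorem exists_hasCubicExpansion_Gamma : ∃ d : ℂ,
    HasCubicExpansion (fun x => Complex.Gamma (1 + x)) 1 (-(Real.eulerMascheroniConstant : ℂ))
      (((Real.eulerMascheroniConstant : ℂ) ^ 2 + (Real.pi : ℂ) ^ 2 / 6) / 2) d := by
  have hne : ∀ x : ℂ, ‖x‖ < 1 → ∀ m : ℕ, 1 + x ≠ -m := by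
    intro x hx m h
    have h1 : x = -((m : ℂ) + 1) := by linear_combination h
    rw [h1, norm_neg, ← Nat.cast_add_one, Complex.norm_natCast] at hx
    have : m + 1 < 1 := by exact_mod_cast hx
    omega
  have han : AnalyticAt ℂ (fun x => Complex.Gamma (1 + x)) 0 := by
    refine DifferentiableOn.analyticAt (s := Metric.ball 0 1) (fun x hx => ?_)
      (Metric.ball_mem_nhds 0 one_pos)
    have h1 := Complex.differentiableAt_Gamma (1 + x) (hne x (by simpa using hx))
    exact (h1.comp x (by fun_prop)).differentiableWithinAt
  have hd : deriv (fun x => Complex.Gamma (1 + x)) 0 = -(Real.eulerMascheroniConstant : ℂ) := by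
    have h1 := Complex.hasDerivAt_Gamma_one
    rw [← add_zero (1 : ℂ)] at h1
    exact (h1.comp_const_add 1 0).deriv
  have h := HasCubicExpansion.of_analyticAt han
  rw [hd, add_zero, Complex.Gamma_one] at h
  have hprod := (h.mul h.comp_neg).mul (HasCubicExpansion.sin_const_mul Real.pi)
  have hlin := HasCubicExpansion.id.const_mul (Real.pi : ℂ)
  have heq : ∀ᶠ x : ℂ in 𝓝[≠] 0, Real.pi * x =
      Complex.Gamma (1 + x) * Complex.Gamma (1 + -x) * Complex.sin (Real.pi * x) := by
    filter_upwards [eventually_ne_zero_and_norm_lt_one] with x hx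
    have h1 := Complex.Gamma_mul_Gamma_one_sub x
    have h2 : Complex.Gamma x ≠ 0 :=
      Complex.Gamma_ne_zero (ne_neg_natCast_of_norm_lt_one hx.1 hx.2)
    have h3 : Complex.Gamma (1 + -x) ≠ 0 := Complex.Gamma_ne_zero (hne _ (by simpa using hx.2))
    rw [sub_eq_add_neg] at h1
    have h4 : Complex.sin (Real.pi * x) ≠ 0 := by
      intro h4
      rw [h4, div_zero] at h1
      exact mul_ne_zero h2 h3 h1
    rw [add_comm 1 x, Complex.Gamma_add_one x hx.1, mul_assoc x, h1, mul_assoc,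
      div_mul_cancel₀ _ h4, mul_comm]
  -- If `c` is the quadratic coefficient, the `x³` coefficient gives `π (2c - γ²) - π³/6 = 0`.
  obtain ⟨-, -, -, h3⟩ := (hlin.congr heq).unique hprod
  refine ⟨_, h.congr_coeff rfl rfl ?_ rfl⟩
  have hpi : (Real.pi : ℂ) ≠ 0 := by exact_mod_cast Real.pi_ne_zero
  refine mul_left_cancel₀ hpi ?_
  linear_combination (-1 / 2 : ℂ) * h3

/-- The substitution `s = 1 - x` absorbs the signs `(-1)^n` of the Laurent expansion. -/
theorem hasCubicExpansion_hurwitzRegularPart (a : ℝ) :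
    HasCubicExpansion (fun x => hurwitzRegularPart a (1 - x)) (generalizedStieltjes 0 a)
      (generalizedStieltjes 1 a) (generalizedStieltjes 2 a / 2)
      (generalizedStieltjes 3 a / 6) := by
  have hR := differentiable_hurwitzRegularPart a
  have han : AnalyticAt ℂ (fun x => hurwitzRegularPart a (1 - x)) 0 :=
    Differentiable.analyticAt (by fun_prop) 0
  have hn : ∀ n, iteratedDeriv n (fun x => hurwitzRegularPart a (1 - x)) 0 =
      generalizedStieltjes n a := by
    intro n
    rw [iteratedDeriv_comp_const_sub, generalizedStieltjes]
    simp
  have h := HasCubicExpansion.of_analyticAt han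
  rw [hn, hn, ← iteratedDeriv_one, hn] at h
  exact h.congr_coeff (by simp [generalizedStieltjes]) rfl rfl rfl

theorem hasCubicExpansion_hurwitzZeta {a : ℝ} (ha : 0 < a) (ha1 : a ≤ 1) :
    HasCubicExpansion (HurwitzZeta.hurwitzZeta (a : UnitAddCircle)) ((1 / 2 - a : ℝ) : ℂ)
      ((Real.log (Real.Gamma a) - Real.log (2 * Real.pi) / 2 : ℝ) : ℂ)
      (hurwitzDerivZero 2 a / 2) (hurwitzDerivZero 3 a / 6) := by
  have han : AnalyticAt ℂ (HurwitzZeta.hurwitzZeta (a : UnitAddCircle)) 0 := by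
    refine DifferentiableOn.analyticAt (s := {1}ᶜ) (fun x hx => ?_)
      (isOpen_compl_singleton.mem_nhds (zero_ne_one' ℂ))
    exact (HurwitzZeta.differentiableAt_hurwitzZeta _ hx).differentiableWithinAt
  refine (HasCubicExpansion.of_analyticAt han).congr_coeff ?_ ?_ rfl rfl
  · rw [hurwitzZeta_apply_zero ha ha1]
    push_cast
    ring
  · rw [← iteratedDeriv_one]
    exact hurwitzDerivZero_one_eq ha ha1

/-! ### The functional equation near 0 and comparison of coefficients. -/

section Rational

variable {r q : ℕ}

theorem hasCubicExpansion_sum_mul_hurwitzZeta (w : ℕ → ℝ) :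
    HasCubicExpansion (fun x => ∑ l ∈ Finset.Ico 1 q, (w l : ℂ) *
        HurwitzZeta.hurwitzZeta (((l : ℝ) / q : ℝ) : UnitAddCircle) x)
      ((∑ l ∈ Finset.Ico 1 q, w l * (1 / 2 - (l : ℝ) / q) : ℝ) : ℂ)
      ((∑ l ∈ Finset.Ico 1 q, w l *
        (Real.log (Real.Gamma ((l : ℝ) / q)) - Real.log (2 * Real.pi) / 2) : ℝ) : ℂ)
      ((∑ l ∈ Finset.Ico 1 q, (w l : ℂ) * hurwitzDerivZero 2 ((l : ℝ) / q)) / 2)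
      ((∑ l ∈ Finset.Ico 1 q, (w l : ℂ) * hurwitzDerivZero 3 ((l : ℝ) / q)) / 6) := by
  have h : ∀ l ∈ Finset.Ico 1 q, _ := fun l hl => by
    rw [Finset.mem_Ico] at hl
    have hq : (0 : ℝ) < q := by exact_mod_cast (show 0 < q by omega)
    have hl0 : (0 : ℝ) < l := by exact_mod_cast hl.1
    have hlq : (l : ℝ) ≤ q := by exact_mod_cast hl.2.le
    exact (hasCubicExpansion_hurwitzZeta (div_pos hl0 hq) ((div_le_one hq).mpr hlq)).const_mul
      (w l : ℂ)
  refine (HasCubicExpansion.sum h).congr_coeff ?_ ?_ ?_ ?_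
  · push_cast
    rfl
  · push_cast
    rfl
  · rw [Finset.sum_div]
    exact Finset.sum_congr rfl fun l _ => (mul_div_assoc _ _ _).symm
  · rw [Finset.sum_div]
    exact Finset.sum_congr rfl fun l _ => (mul_div_assoc _ _ _).symm

theorem mul_hurwitzRegularPart_one_sub (a : ℝ) {x : ℂ} (hx : x ≠ 0) :
    x * hurwitzRegularPart a (1 - x) - 1 =
      x * HurwitzZeta.hurwitzZeta (a : UnitAddCircle) (1 - x) := by
  have h1 : 1 - x ≠ 1 := by simpa using hx
  rw [hurwitzRegularPart_of_ne h1]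
  have : 1 - x - 1 = -x := by ring
  rw [this]
  field_simp
  ring

/-- Hurwitz's formula times `x`, with `x Γ(x) = Γ(1 + x)`. The class `k = 0`, where the sine weight
vanishes, is recognised as Riemann's functional equation. -/
theorem mul_hurwitzRegularPart_natCast_div (hr : 0 < r) (hrq : r < q) {x : ℂ} (hx : x ≠ 0)
    (hx1 : ‖x‖ < 1) :
    x * hurwitzRegularPart ((r : ℝ) / q) (1 - x) - 1 =
      Complex.exp (-(Real.log q : ℂ) * x) * (x * hurwitzRegularPart 0 (1 - x) - 1) +
      2 * (Complex.exp (-(Real.log (2 * Real.pi * q) : ℂ) * x) * Complex.Gamma (1 + x) *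
        (Complex.cos (Real.pi / 2 * x) * (∑ l ∈ Finset.Ico 1 q,
            ((Real.cos (2 * Real.pi * r * l / q) : ℝ) : ℂ) *
            HurwitzZeta.hurwitzZeta (((l : ℝ) / q : ℝ) : UnitAddCircle) x) +
          Complex.sin (Real.pi / 2 * x) * (∑ l ∈ Finset.Ico 1 q,
            ((Real.sin (2 * Real.pi * r * l / q) : ℝ) : ℂ) *
            HurwitzZeta.hurwitzZeta (((l : ℝ) / q : ℝ) : UnitAddCircle) x))) := by
  have hn := ne_neg_natCast_of_norm_lt_one hx hx1
  have hx1' : x ≠ 1 := by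
    rintro rfl
    simp at hx1
  have hq : (0 : ℝ) < q := by exact_mod_cast hr.trans hrq
  have hp : (0 : ℝ) < 2 * Real.pi := by positivity
  rw [mul_hurwitzRegularPart_one_sub _ hx, mul_hurwitzRegularPart_one_sub _ hx,
    QuotientAddGroup.mk_zero, HurwitzZeta.hurwitzZeta_zero, riemannZeta_one_sub hn hx1',
    hurwitzZeta_natCast_div_one_sub hr hrq hn hx1', Finset.range_eq_Ico,
    Finset.sum_eq_sum_Ico_succ_bot (hr.trans hrq), add_comm 1 x, Complex.Gamma_add_one x hx]
  have e1 : (q : ℂ) ^ (-x) = Complex.exp (-(Real.log q : ℂ) * x) := by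
    have := ofReal_cpow_eq_cexp hq (-x)
    rw [mul_neg, ← neg_mul] at this
    exact_mod_cast this
  have e2 : Complex.exp (-(Real.log (2 * Real.pi * q) : ℂ) * x) =
      (2 * Real.pi : ℂ) ^ (-x) * Complex.exp (-(Real.log q : ℂ) * x) := by
    have := ofReal_cpow_eq_cexp hp (-x)
    push_cast at this
    rw [this, ← Complex.exp_add, Real.log_mul hp.ne' hq.ne']
    push_cast
    ring_nf
  rw [e1, e2]
  simp only [add_mul, Finset.sum_add_distrib, mul_assoc (Complex.cos (Real.pi * x / 2)),
    mul_assoc (Complex.sin (Real.pi * x / 2)), ← Finset.mul_sum]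
  rw [mul_div_right_comm (Real.pi : ℂ) x 2]
  simp only [Nat.cast_zero, mul_zero, zero_div, Real.cos_zero, Real.sin_zero,
    QuotientAddGroup.mk_zero, HurwitzZeta.hurwitzZeta_zero, Complex.ofReal_one,
    Complex.ofReal_zero, zero_mul, zero_add]
  ring

end Rational

theorem mainTheorem7 (r q : ℕ) (hr : 0 < r) (hrq : r < q) :
    generalizedStieltjes 0 ((r : ℝ) / q) =
      ((Real.eulerMascheroniConstant + Real.log (2 * q)
        + Real.pi / 2 * Real.cot (Real.pi * r / q)
        - ∑ l ∈ Finset.Ico 1 q,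
            Real.cos (2 * Real.pi * r * l / q) * Real.log (Real.sin (Real.pi * l / q)) : ℝ) : ℂ) ∧
    generalizedStieltjes 1 ((r : ℝ) / q) =
      (eulerStieltjes 1 : ℂ)
        - ((Real.eulerMascheroniConstant * Real.log (2 * q) : ℝ) : ℂ)
        - ((Real.pi / 2 * (Real.eulerMascheroniConstant + Real.log (2 * Real.pi * q))
            * Real.cot (Real.pi * r / q) : ℝ) : ℂ)
        + ∑ l ∈ Finset.Ico 1 q,
            (Real.cos (2 * Real.pi * r * l / q) : ℂ) * hurwitzDerivZero 2 ((l : ℝ) / q)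
        + ((Real.pi * ∑ l ∈ Finset.Ico 1 q,
            Real.sin (2 * Real.pi * r * l / q) * Real.log (Real.Gamma ((l : ℝ) / q)) : ℝ) : ℂ)
        + (((Real.eulerMascheroniConstant + Real.log (2 * Real.pi * q)) *
            ∑ l ∈ Finset.Ico 1 q,
              Real.cos (2 * Real.pi * r * l / q) *
                Real.log (Real.sin (Real.pi * l / q)) : ℝ) : ℂ)
        - ((Real.log 2 ^ 2 + Real.log 2 * Real.log (Real.pi * q)
            + 1 / 2 * Real.log q ^ 2 : ℝ) : ℂ) ∧
    generalizedStieltjes 2 ((r : ℝ) / q) =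
      (eulerStieltjes 2 : ℂ)
        - ((2 * eulerStieltjes 1 * Real.log q : ℝ) : ℂ)
        + ((Real.eulerMascheroniConstant * Real.log q ^ 2 + 1 / 3 * Real.log q ^ 3 : ℝ) : ℂ)
        + 2 / 3 * ∑ l ∈ Finset.Ico 1 q,
            (Real.cos (2 * Real.pi * r * l / q) : ℂ) * hurwitzDerivZero 3 ((l : ℝ) / q)
        + Real.pi * ∑ l ∈ Finset.Ico 1 q,
            (Real.sin (2 * Real.pi * r * l / q) : ℂ) * hurwitzDerivZero 2 ((l : ℝ) / q)
        - 2 * ((Real.eulerMascheroniConstant + Real.log (2 * Real.pi * q) : ℝ) : ℂ) *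
            ((∑ l ∈ Finset.Ico 1 q,
                (Real.cos (2 * Real.pi * r * l / q) : ℂ) * hurwitzDerivZero 2 ((l : ℝ) / q))
              + ((Real.pi * ∑ l ∈ Finset.Ico 1 q,
                  Real.sin (2 * Real.pi * r * l / q) *
                    Real.log (Real.Gamma ((l : ℝ) / q)) : ℝ) : ℂ))
        + ((((Real.eulerMascheroniConstant + Real.log (2 * Real.pi * q)) ^ 2
              - Real.pi ^ 2 / 12) *
            (Real.log 2 - ∑ l ∈ Finset.Ico 1 q,
              Real.cos (2 * Real.pi * r * l / q) *
                Real.log (Real.sin (Real.pi * l / q))) : ℝ) : ℂ)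
        + ((Real.pi / 2 * ((Real.eulerMascheroniConstant + Real.log (2 * Real.pi * q)) ^ 2
              + Real.pi ^ 2 / 12) * Real.cot (Real.pi * r / q) : ℝ) : ℂ) := by
  obtain ⟨g3, hG⟩ := exists_hasCubicExpansion_Gamma
  have hL := (HasCubicExpansion.id.mul (hasCubicExpansion_hurwitzRegularPart ((r : ℝ) / q))).add
    (HasCubicExpansion.const (-1))
  have hZ := (HasCubicExpansion.cexp_const_mul (-(Real.log q : ℂ))).mul
    ((HasCubicExpansion.id.mul (hasCubicExpansion_hurwitzRegularPart 0)).add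
      (HasCubicExpansion.const (-1)))
  have hC := hasCubicExpansion_sum_mul_hurwitzZeta (q := q)
    (fun l => Real.cos (2 * Real.pi * r * l / q))
  have hD := hasCubicExpansion_sum_mul_hurwitzZeta (q := q)
    (fun l => Real.sin (2 * Real.pi * r * l / q))
  rw [sum_cos_mul_natCast (hr.trans hrq), sum_cos_mul_log_Gamma hr hrq] at hC
  -- The constant `log(2π)/2` drops out because the sines sum to 0.
  simp only [mul_sub (Real.sin _) (Real.log _), Finset.sum_sub_distrib, ← Finset.sum_mul,
    sum_sin_two_pi_mul_div, zero_mul, sub_zero, sum_sin_mul_natCast hr hrq] at hD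
  have hR := hZ.add ((((HasCubicExpansion.cexp_const_mul (-(Real.log (2 * Real.pi * q) : ℂ))).mul
    hG).mul (((HasCubicExpansion.cos_const_mul (Real.pi / 2)).mul hC).add
      ((HasCubicExpansion.sin_const_mul (Real.pi / 2)).mul hD))).const_mul 2)
  -- Both constant terms are `-1` and carry no information.
  obtain ⟨-, h1, h2, h3⟩ := (hL.congr (eventually_ne_zero_and_norm_lt_one.mono fun x hx => by
    simpa only [sub_eq_add_neg _ (1 : ℂ)] using
      mul_hurwitzRegularPart_natCast_div hr hrq hx.1 hx.2)).unique hR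
  simp only [generalizedStieltjes_zero_right, eulerStieltjes_zero] at h1 h2 h3
  have hq : (q : ℝ) ≠ 0 := by exact_mod_cast (hr.trans hrq).ne'
  have hl1 : Real.log (2 * q) = Real.log 2 + Real.log q := Real.log_mul two_ne_zero hq
  have hl2 : Real.log (Real.pi * q) = Real.log Real.pi + Real.log q :=
    Real.log_mul Real.pi_ne_zero hq
  have hl3 : Real.log (2 * Real.pi * q) = Real.log 2 + Real.log Real.pi + Real.log q := by
    rw [mul_assoc, Real.log_mul two_ne_zero (mul_ne_zero Real.pi_ne_zero hq), hl2, add_assoc]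
  rw [hl3] at h1 h2 h3
  rw [hl1, hl2, hl3]
  generalize ∑ l ∈ Finset.Ico 1 q,
    Real.cos (2 * Real.pi * r * l / q) * Real.log (Real.sin (Real.pi * l / q)) = S at *
  generalize ∑ l ∈ Finset.Ico 1 q,
    Real.sin (2 * Real.pi * r * l / q) * Real.log (Real.Gamma ((l : ℝ) / q)) = G at *
  generalize ∑ l ∈ Finset.Ico 1 q,
    (Real.cos (2 * Real.pi * r * l / q) : ℂ) * hurwitzDerivZero 2 ((l : ℝ) / q) = A₂ at *
  generalize ∑ l ∈ Finset.Ico 1 q,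
    (Real.cos (2 * Real.pi * r * l / q) : ℂ) * hurwitzDerivZero 3 ((l : ℝ) / q) = A₃ at *
  generalize ∑ l ∈ Finset.Ico 1 q,
    (Real.sin (2 * Real.pi * r * l / q) : ℂ) * hurwitzDerivZero 2 ((l : ℝ) / q) = B at *
  generalize Real.cot (Real.pi * r / q) = T at *
  generalize Real.log 2 = L₂ at *
  generalize Real.log Real.pi = Lp at *
  generalize Real.log q = Lq at *
  push_cast at h1 h2 h3 ⊢
  refine ⟨?_, ?_, ?_⟩
  · linear_combination h1
  -- Once the sums and logarithms are atoms, each formula is a polynomial identity. The factor 2 in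
  -- the last one clears the denominator of `γ₂(r/q)/2`.
  · linear_combination h2
  · linear_combination 2 * h3
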